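/- For a commutative ring $A$ let $\mathcal V(A)$ be the set of binary cubic forms $f=aX^3+bX^2Y+cXY^2+dY^3$ with $a,b,c,d\in A$, identified with $A^4$, with the action $(Mf)(v)=\det(M)^{-1}f(M^Tv)$ of $\mathrm{GL}_2(A)$. Write $\operatorname{disc}(f)=b^2c^2-4ac^3-4b^3d-27a^2d^2+18abcd$. Fix $r\in\{1,3\}$. Let $\mathcal V^r(\mathbb R)$ be the set of squarefree real binary cubic forms with exactly $r$ roots in $\mathbb P^1(\mathbb R)$, let $\mathcal V^r(\mathbb Z)=\mathcal V(\mathbb Z)\cap\mathcal V^r(\mathbb R)$, and let $\mathcal W^r(\mathbb R)=\{f\in\mathcal V^r(\mathbb R):|\operatorname{disc}(f)|=1\}$. Let $B=\{f\in\mathcal V(\mathbb R): q(f)<1\}$ with $q(f)=5a^2+b^2+c^2+5d^2+2ac+2bd$, and fix $R>0$ such that $R\cdot B\cap\mathcal W^r(\mathbb R)\neq\emptyset$. For $t\in\mathbb R$ and $s>0$ put $n(t)=\begin{pmatrix}1&0\\t&1\end{pmatrix}$ and $a(s)=\begin{pmatrix}s^{-1}&0\\0&s\end{pmatrix}$. For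 $\lambda>0$ put $s_{\min}=\sqrt{\sqrt3/2}$, $s_{\max}=\sqrt[3]{\lambda/2}$, $$(l_1,l_2,l_3,l_4)=(\lambda s^{-3},\sqrt5\lambda s^{-1},\sqrt5\lambda s,\lambda s^3),\qquad l_i'=\lfloor 1+l_i\rfloor,\qquad I'=\prod_{i=1}^4\left[-\tfrac12l_i',\tfrac12l_i'\right),$$ $$(L_1',L_2',L_3',L_4')=(s_{\max}^3+\lambda,\ s_{\max}+\sqrt5\lambda,\ s_{\min}^{-1}+\sqrt5\lambda,\ s_{\min}^{-3}+\lambda).$$ For a real number $T\ge1$ let $\lambda=RT^{1/4}$ and consider the following randomized algorithm (in exact real arithmetic). 1. Pick $t\in(-\frac12,\frac12)$ uniformly at random and, independently, $s\in(s_{\min},\infty)$ with probability measure proportional to $s^{-2}\,d^\times s=s^{-3}\,ds$. 2. Fail unless $\sqrt[4]{1-t^2}<s<s_{\max}$. 3. Fail with probability $1-\frac{l_1'l_2'l_3'l_4'}{L_1'L_2'L_3'L_4'}$. 4. Pick a point $f\in\mathcal V(\mathbb Z)\cap n(t)I'$ uniformly at random, as follows: let $(m'_{ij})$ be the inverse of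 the (lower triangular unipotent) matrix by which $n(t)$ acts on $\mathcal V(\mathbb R)=\mathbb R^4$; for $i=1,\dots,4$ in turn pick $\delta_i\in\{0,\dots,l_i'-1\}$ uniformly at random and let the $i$-th coefficient of $f$ be $v_i=\lceil-\frac12l_i'-\sum_{j<i}m'_{ij}v_j\rceil+\delta_i$. 5. Fail unless $f\in\mathcal V^r(\mathbb R)$, $0<|\operatorname{disc}(f)|\le T$, $f$ is irreducible over $\mathbb Q$, and $f\in R|\operatorname{disc}(f)|^{1/4}\cdot n(t)a(s)B$. 6. Return $f$. Then: (a) For every $T\ge1$ the algorithm either fails or returns a form $f\in\mathcal V^r(\mathbb Z)$ that is irreducible over $\mathbb Q$ and satisfies $0<|\operatorname{disc}(f)|\le T$. (b) For every $T\ge1$ there is a constant $D>0$ (depending on $r,R,T$) such that for every $f\in\mathcal V^r(\mathbb Z)$ that is irreducible over $\mathbb Q$ and satisfies $0<|\operatorname{disc}(f)|\le T$, the group $\mathrm{Stab}_{\mathrm{GL}_2(\mathbb Z)}(f)$ is finite and the probability that the algorithm returns an element of the orbit $\mathrm{GL}_2(\mathbb Z)f$ is $D/\#\mathrm{Stab}_{\mathrm{GL}_2(\mathbb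 Z)}(f)$. (c) There is a constant $p_0>0$, depending only on $r$ and $R$ and not on $T$, such that for every $T\ge1$ for which at least one form as in (b) exists, the algorithm succeeds (does not fail) with probability greater than $p_0$. -/

import Mathlib

open MeasureTheory Set
open scoped ENNReal NNReal Pointwise LinearAlgebra.Projectivization

/-- The binary cubic form `a X³ + b X²Y + c XY² + d Y³`. -/
@[ext]
structure BinaryCubicForm (A : Type*) where
  a : A
  b : A
  c : A
  d : A

namespace BinaryCubicForm

variable {A B : Type*} [CommRing A] [CommRing B]

/-- The coefficient vector `(a, b, c, d)`. -/
def coeffs {A : Type*} (f : BinaryCubicForm A) : Fin 4 → A := ![f.a, f.b, f.c, f.d]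

/-- The form with a given coefficient vector. -/
def ofCoeffs {A : Type*} (v : Fin 4 → A) : BinaryCubicForm A := ⟨v 0, v 1, v 2, v 3⟩

/-- Change of coefficient ring. -/
def map (φ : A →+* B) (f : BinaryCubicForm A) : BinaryCubicForm B :=
  ⟨φ f.a, φ f.b, φ f.c, φ f.d⟩

/-- The value of the form at the vector `v = (x, y)`. -/
def eval (f : BinaryCubicForm A) (v : Fin 2 → A) : A :=
  f.a * v 0 ^ 3 + f.b * v 0 ^ 2 * v 1 + f.c * v 0 * v 1 ^ 2 + f.d * v 1 ^ 3

/-- The form as a polynomial in the two variables `X = X 0` and `Y = X 1`. -/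
noncomputable def toMvPolynomial (f : BinaryCubicForm A) : MvPolynomial (Fin 2) A :=
  MvPolynomial.C f.a * MvPolynomial.X 0 ^ 3
    + MvPolynomial.C f.b * MvPolynomial.X 0 ^ 2 * MvPolynomial.X 1
    + MvPolynomial.C f.c * MvPolynomial.X 0 * MvPolynomial.X 1 ^ 2
    + MvPolynomial.C f.d * MvPolynomial.X 1 ^ 3

/-- The discriminant of a binary cubic form. -/
def disc (f : BinaryCubicForm A) : A :=
  f.b ^ 2 * f.c ^ 2 - 4 * f.a * f.c ^ 3 - 4 * f.b ^ 3 * f.d - 27 * f.a ^ 2 * f.d ^ 2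
    + 18 * f.a * f.b * f.c * f.d

/-- Multiplication of a form by a scalar. -/
instance : SMul A (BinaryCubicForm A) where
  smul x f := ⟨x * f.a, x * f.b, x * f.c, x * f.d⟩

/-- The form `v ↦ f (Mᵀ v)`, that is, `f (M₀₀ X + M₁₀ Y, M₀₁ X + M₁₁ Y)` expanded. -/
def subst (M : Matrix (Fin 2) (Fin 2) A) (f : BinaryCubicForm A) : BinaryCubicForm A where
  a := f.a * M 0 0 ^ 3 + f.b * M 0 0 ^ 2 * M 0 1 + f.c * M 0 0 * M 0 1 ^ 2 + f.d * M 0 1 ^ 3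
  b := 3 * f.a * M 0 0 ^ 2 * M 1 0 + f.b * (M 0 0 ^ 2 * M 1 1 + 2 * M 0 0 * M 1 0 * M 0 1)
    + f.c * (M 1 0 * M 0 1 ^ 2 + 2 * M 0 0 * M 0 1 * M 1 1) + 3 * f.d * M 0 1 ^ 2 * M 1 1
  c := 3 * f.a * M 0 0 * M 1 0 ^ 2 + f.b * (M 1 0 ^ 2 * M 0 1 + 2 * M 0 0 * M 1 0 * M 1 1)
    + f.c * (M 0 0 * M 1 1 ^ 2 + 2 * M 1 0 * M 0 1 * M 1 1) + 3 * f.d * M 0 1 * M 1 1 ^ 2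
  d := f.a * M 1 0 ^ 3 + f.b * M 1 0 ^ 2 * M 1 1 + f.c * M 1 0 * M 1 1 ^ 2 + f.d * M 1 1 ^ 3

/-- The twisted action `(M f)(v) = det(M)⁻¹ f(Mᵀ v)` of `GL₂` on binary cubic forms. -/
instance : MulAction (Matrix.GeneralLinearGroup (Fin 2) A) (BinaryCubicForm A) where
  smul M f := (((Matrix.GeneralLinearGroup.det M)⁻¹ : Aˣ) : A) • subst M.val f
  one_smul f := by
    change (((Matrix.GeneralLinearGroup.det (1 : Matrix.GeneralLinearGroup (Fin 2) A))⁻¹ : Aˣ) : A)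
      • subst (1 : Matrix (Fin 2) (Fin 2) A) f = f
    rw [map_one, inv_one, Units.val_one]
    ext <;> simp [subst, HSMul.hSMul, SMul.smul]
  mul_smul M N f := by
    change (((Matrix.GeneralLinearGroup.det (M * N))⁻¹ : Aˣ) : A) • subst (M.val * N.val) f
      = (((Matrix.GeneralLinearGroup.det M)⁻¹ : Aˣ) : A) • subst M.val
        ((((Matrix.GeneralLinearGroup.det N)⁻¹ : Aˣ) : A) • subst N.val f)
    rw [map_mul, mul_inv, Units.val_mul]
    generalize (((Matrix.GeneralLinearGroup.det M)⁻¹ : Aˣ) : A) = x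
    generalize (((Matrix.GeneralLinearGroup.det N)⁻¹ : Aˣ) : A) = y
    ext <;> simp only [subst, HSMul.hSMul, SMul.smul, Matrix.mul_apply, Fin.sum_univ_two] <;> ring

theorem eval_smul (M : Matrix.GeneralLinearGroup (Fin 2) A) (f : BinaryCubicForm A)
    (v : Fin 2 → A) :
    (M • f).eval v
      = (((Matrix.GeneralLinearGroup.det M)⁻¹ : Aˣ) : A) * f.eval (M.val.transpose.mulVec v) := by
  change eval ((((Matrix.GeneralLinearGroup.det M)⁻¹ : Aˣ) : A) • subst M.val f) v = _
  generalize (((Matrix.GeneralLinearGroup.det M)⁻¹ : Aˣ) : A) = x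
  simp only [eval, subst, HSMul.hSMul, SMul.smul, Matrix.mulVec, dotProduct, Fin.sum_univ_two,
    Matrix.transpose_apply]
  ring

/-- An integral form viewed as a real form. -/
noncomputable def toReal (f : BinaryCubicForm ℤ) : BinaryCubicForm ℝ := f.map (Int.castRingHom ℝ)

/-- Irreducibility over `ℚ` of an integral form. -/
def IrreducibleOverRat (f : BinaryCubicForm ℤ) : Prop :=
  Irreducible (f.map (Int.castRingHom ℚ)).toMvPolynomial

/-- The set of squarefree real binary cubic forms with exactly `r` roots in `ℙ¹(ℝ)`. -/
def signatureSet (r : ℕ) : Set (BinaryCubicForm ℝ) :=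
  {f | Squarefree f.toMvPolynomial ∧ {p : ℙ ℝ (Fin 2 → ℝ) | f.eval p.rep = 0}.ncard = r}

/-- The forms in `signatureSet r` of discriminant `±1`. -/
def unitDiscSet (r : ℕ) : Set (BinaryCubicForm ℝ) :=
  {f | f ∈ signatureSet r ∧ |f.disc| = 1}

/-- The `O₂(ℝ)`-invariant quadratic form `q`. -/
def q (f : BinaryCubicForm ℝ) : ℝ :=
  5 * f.a ^ 2 + f.b ^ 2 + f.c ^ 2 + 5 * f.d ^ 2 + 2 * f.a * f.c + 2 * f.b * f.d

/-- The open unit ball for the norm `√q`. -/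
def unitBall : Set (BinaryCubicForm ℝ) := {f | √(q f) < 1}

/-- The forms whose orbits are to be sampled: irreducible over `ℚ`, squarefree with `r` real roots,
and `0 < |disc f| ≤ T`. -/
def IsTarget (r : ℕ) (T : ℝ) (f : BinaryCubicForm ℤ) : Prop :=
  f.IrreducibleOverRat ∧ f.toReal ∈ signatureSet r ∧ 0 < |f.toReal.disc| ∧ |f.toReal.disc| ≤ T

end BinaryCubicForm

namespace CubicSampling

open BinaryCubicForm

/-- The lower unipotent matrix `n(t)`. -/
noncomputable def nMat (t : ℝ) : Matrix.GeneralLinearGroup (Fin 2) ℝ :=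
  Matrix.GeneralLinearGroup.mkOfDetNeZero !![1, 0; t, 1] (by simp)

open Classical in
/-- The diagonal matrix `a(s) = diag(s⁻¹, s)` (with the junk value `1` at `s = 0`). -/
noncomputable def aMat (s : ℝ) : Matrix.GeneralLinearGroup (Fin 2) ℝ :=
  if hs : s ≠ 0 then
    Matrix.GeneralLinearGroup.mkOfDetNeZero !![s⁻¹, 0; 0, s] (by simp [hs])
  else 1

/-- The matrix by which `n(t)` acts on coefficient vectors. -/
def nAct (t : ℝ) : Matrix (Fin 4) (Fin 4) ℝ :=
  !![1, 0, 0, 0; 3 * t, 1, 0, 0; 3 * t ^ 2, 2 * t, 1, 0; t ^ 3, t ^ 2, t, 1]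

theorem coeffs_nMat_smul (t : ℝ) (f : BinaryCubicForm ℝ) :
    (nMat t • f).coeffs = (nAct t).mulVec f.coeffs := by
  have h : nMat t • f = subst !![1, 0; t, 1] f := by
    change (((Matrix.GeneralLinearGroup.det (nMat t))⁻¹ : ℝˣ) : ℝ) • subst !![1, 0; t, 1] f = _
    have hd : Matrix.GeneralLinearGroup.det (nMat t) = 1 := by
      ext
      simp [nMat, Matrix.GeneralLinearGroup.mkOfDetNeZero]
    rw [hd, inv_one, Units.val_one]
    ext <;> simp [HSMul.hSMul, SMul.smul]
  rw [h]
  ext i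
  fin_cases i <;>
    simp [coeffs, subst, nAct, Matrix.mulVec, dotProduct, Fin.sum_univ_four] <;> ring

/-- The number `s_min = √(√3 / 2)`. -/
noncomputable def sMin : ℝ := √(√3 / 2)

/-- The number `s_max = ∛(lam / 2)`. -/
noncomputable def sMax (lam : ℝ) : ℝ := (lam / 2) ^ (1 / 3 : ℝ)

/-- The side lengths `l_i(lam, s)` of the box `lam · a(s) I`. -/
noncomputable def side (lam s : ℝ) : Fin 4 → ℝ :=
  ![lam * (s ^ 3)⁻¹, √5 * lam * s⁻¹, √5 * lam * s, lam * s ^ 3]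

/-- The integer side lengths `l_i'(lam, s) = ⌊1 + l_i(lam, s)⌋`. -/
noncomputable def intSide (lam s : ℝ) (i : Fin 4) : ℕ := ⌊1 + side lam s i⌋₊

/-- The constants `L_i'(lam)`. -/
noncomputable def boundSide (lam : ℝ) : Fin 4 → ℝ :=
  ![sMax lam ^ 3 + lam, sMax lam + √5 * lam, sMin⁻¹ + √5 * lam, (sMin ^ 3)⁻¹ + lam]

/-- A uniformly random element of `{0, …, l - 1}` (with the junk value `0` if `l = 0`). -/
noncomputable def uniformBelow (l : ℕ) : PMF ℕ :=
  if h : l = 0 then PMF.pure 0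
  else PMF.uniformOfFinset (Finset.range l) (Finset.nonempty_range_iff.mpr h)

/-- A coin that shows `true` with probability `p` (with probability `1` if `p > 1`). -/
noncomputable def coin (p : ℝ≥0) : PMF Bool :=
  PMF.ofFintype (fun b => cond b (min p 1 : ℝ≥0) (1 - min p 1 : ℝ≥0)) (by
    rw [Fintype.sum_bool, cond_true, cond_false, ← ENNReal.coe_add,
      add_tsub_cancel_of_le (min_le_right p 1), ENNReal.coe_one])

/-- Random lattice point of `M I`, where `I` is the product of the intervals `[x_i, x_i + l_i)`
and `M` is a lower triangular unipotent matrix: for `i = 1, …, n` in turn, pick `δ` uniformly from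
`{0, …, l_i - 1}` and put `v_i = ⌈x_i - ∑_{j < i} m'_{ij} v_j⌉ + δ`, where `M⁻¹ = (m'_{ij})`. -/
noncomputable def samplePoint {n : ℕ} (x : Fin n → ℝ) (l : Fin n → ℕ)
    (M : Matrix (Fin n) (Fin n) ℝ) : PMF (Fin n → ℤ) :=
  (List.finRange n).foldlM (fun v i => do
    let δ ← uniformBelow (l i)
    pure (Function.update v i (⌈x i - ∑ j with j < i, M⁻¹ i j * v j⌉ + δ))) 0

open Classical in
/-- The sampling algorithm with parameters `r`, `R`, `T` after the real numbers `t` and `s` have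
been drawn; `none` stands for failure. -/
noncomputable def runAt (r : ℕ) (R T t s : ℝ) : PMF (Option (BinaryCubicForm ℤ)) :=
  let lam := R * T ^ (1 / 4 : ℝ)
  if (1 - t ^ 2) ^ (1 / 4 : ℝ) < s ∧ s < sMax lam then do
    let go ← coin (((∏ i, (intSide lam s i : ℝ)) / ∏ i, boundSide lam i).toNNReal)
    if go = true then do
      let v ← samplePoint (fun i => -(1 / 2) * (intSide lam s i : ℝ)) (intSide lam s) (nAct t)
      let f := ofCoeffs v
      if f.toReal ∈ signatureSet r ∧ (0 < |f.toReal.disc| ∧ |f.toReal.disc| ≤ T) ∧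
          f.IrreducibleOverRat ∧
          f.toReal ∈ (R * |f.toReal.disc| ^ (1 / 4 : ℝ)) • (nMat t * aMat s) • unitBall then
        pure (some f)
      else pure none
    else pure none
  else pure none

/-- The uniform distribution on `(-1/2, 1/2)`. -/
noncomputable def tLaw : Measure ℝ := ProbabilityTheory.cond volume (Ioo (-1 / 2) (1 / 2))

/-- The measure `s⁻² d×s = s⁻³ ds` on `(s_min, ∞)`. -/
noncomputable def sMeasure : Measure ℝ :=
  (volume.restrict (Ioi sMin)).withDensity fun s => ENNReal.ofReal ((s ^ 3)⁻¹)

/-- The probability measure on `(s_min, ∞)` proportional to `s⁻² d×s`. -/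
noncomputable def sLaw : Measure ℝ := (sMeasure univ)⁻¹ • sMeasure

/-- The countable set of possible outputs carries the discrete `σ`-algebra. -/
instance : MeasurableSpace (Option (BinaryCubicForm ℤ)) := ⊤

/-- The distribution of the output of the sampling algorithm: `t` and `s` are drawn independently
from `tLaw` and `sLaw`, and then the remaining steps are carried out. -/
noncomputable def outputLaw (r : ℕ) (R T : ℝ) : Measure (Option (BinaryCubicForm ℤ)) :=
  (tLaw.prod sLaw).bind fun p => (runAt r R T p.1 p.2).toMeasure

end CubicSampling

/-! The argument is an unfolding over the modular fundamental domain. Put g = n(t)a(s) and τ = t +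
is² in the upper half-plane. The number q(g⁻¹f) is the `height` of f at τ, a covariant of f: a real
matrix acting on f and, through `twist`, on τ multiplies it by |det| (`height_gl_smul`). The
discriminant is multiplied by det², so `lowSet R f`, the set of τ with height below R²√|disc f|,
moves along with f. The ball test of step 5 says exactly that τ ∈ `lowSet R f`, and the condition on
s in step 2 puts τ in the open fundamental domain 𝒟ᵒ.

For fixed (t, s), a target form f is returned with probability independent of f, t and s whenever τ
∈ 𝒟ᵒ ∩ `lowSet R f`, and never otherwise (`runAt_apply_some_eq`): f lies in the sampled box, which
has ∏ lᵢ' equally likely points, and the coin of step 3 turns 1/∏ lᵢ' into 1/∏ Lᵢ'. The cutoff s <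
s_max loses nothing, because irreducibility makes the leading coefficient a nonzero integer. Since
s⁻³ ds dt is half the hyperbolic measure, f is returned with probability proportional to vol(𝒟ᵒ ∩
`lowSet R f`) (`outputLaw_singleton`).

Summing over γ ∈ GL₂(ℤ) in place of the orbit costs a factor #Stab(f)
(`MulAction.card_stabilizer_mul_tsum_orbit`), and the sum over γ is 4·vol(`lowSet R f`), because
almost every point is moved into 𝒟ᵒ by exactly four elements (`tsum_volume_fdo_inter`). All real
forms of one discriminant sign form a single GL₂(ℝ)-orbit, so this volume depends only on r and R
(`volume_lowSet_eq`). This gives (b).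

For (c), bounded T is handled by one orbit, using a uniform bound on stabilizers
(`outputLaw_ge_of_le`). For large T there are at least a constant times T forms, irreducible already
modulo 2, whose low sets contain a common open U ⊆ 𝒟ᵒ (`exists_many_targets`), while each is
returned with probability at least a constant times vol(U)/T (`outputLaw_ge_of_large`). -/

namespace BinaryCubicForm

/-! ### Equivariance of the discriminant and of the associated polynomial; squarefreeness and
irreducibility -/

section Algebra

variable {A : Type*} [CommRing A]

theorem smul_def (x : A) (f : BinaryCubicForm A) :
    x • f = ⟨x * f.a, x * f.b, x * f.c, x * f.d⟩ := rfl

theorem gl_smul_def (M : GL (Fin 2) A) (f : BinaryCubicForm A) :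
    M • f = (((Matrix.GeneralLinearGroup.det M)⁻¹ : Aˣ) : A) • subst M.val f := rfl

theorem det_smul_gl_smul (M : GL (Fin 2) A) (f : BinaryCubicForm A) :
    M.val.det • (M • f) = subst M.val f := by
  rw [gl_smul_def]
  have h : M.val.det * (((Matrix.GeneralLinearGroup.det M)⁻¹ : Aˣ) : A) = 1 :=
    Units.mul_inv (Matrix.GeneralLinearGroup.det M)
  ext <;> simp only [smul_def, ← mul_assoc, h, one_mul]

theorem disc_smul (x : A) (f : BinaryCubicForm A) : (x • f).disc = x ^ 4 * f.disc := by
  simp only [disc, smul_def]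
  ring

theorem disc_subst (M : Matrix (Fin 2) (Fin 2) A) (f : BinaryCubicForm A) :
    (subst M f).disc = M.det ^ 6 * f.disc := by
  simp only [disc, subst, Matrix.det_fin_two]
  ring

theorem disc_gl_smul (M : GL (Fin 2) A) (f : BinaryCubicForm A) :
    (M • f).disc = M.val.det ^ 2 * f.disc := by
  have h : (((Matrix.GeneralLinearGroup.det M)⁻¹ : Aˣ) : A) * M.val.det = 1 :=
    Units.inv_mul (Matrix.GeneralLinearGroup.det M)
  rw [gl_smul_def, disc_smul, disc_subst]
  generalize (((Matrix.GeneralLinearGroup.det M)⁻¹ : Aˣ) : A) = x at h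
  calc x ^ 4 * (M.val.det ^ 6 * f.disc) = (x * M.val.det) ^ 4 * (M.val.det ^ 2 * f.disc) := by ring
    _ = _ := by rw [h]; ring

theorem smul_smul_comm (x : A) (M : GL (Fin 2) A) (f : BinaryCubicForm A) :
    M • x • f = x • M • f := by
  simp only [gl_smul_def]
  ext <;> simp only [smul_def, subst] <;> ring

theorem eval_smul_vec (f : BinaryCubicForm A) (x : A) (v : Fin 2 → A) :
    f.eval (x • v) = x ^ 3 * f.eval v := by
  simp only [eval, Pi.smul_apply, smul_eq_mul]
  ring

theorem map_gl_smul {B : Type*} [CommRing B] (φ : A →+* B) (M : GL (Fin 2) A)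
    (f : BinaryCubicForm A) :
    (M • f).map φ = (Matrix.GeneralLinearGroup.map φ M) • f.map φ := by
  have h : φ ((((Matrix.GeneralLinearGroup.det M)⁻¹ : Aˣ) : A))
      = (((Matrix.GeneralLinearGroup.det (Matrix.GeneralLinearGroup.map φ M))⁻¹ : Bˣ) : B) := by
    rw [Matrix.GeneralLinearGroup.map_det, ← map_inv]
    rfl
  rw [gl_smul_def, gl_smul_def, ← h]
  ext <;> simp only [map, smul_def, subst, Matrix.GeneralLinearGroup.map_apply, map_mul, map_add,
    map_pow, map_ofNat]

/-- The substitution of variables by which `subst M` acts on polynomials. -/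
noncomputable def substHom (M : Matrix (Fin 2) (Fin 2) A) :
    MvPolynomial (Fin 2) A →ₐ[A] MvPolynomial (Fin 2) A :=
  MvPolynomial.aeval fun j =>
    MvPolynomial.C (M 0 j) * MvPolynomial.X 0 + MvPolynomial.C (M 1 j) * MvPolynomial.X 1

theorem substHom_mul (M N : Matrix (Fin 2) (Fin 2) A) (p : MvPolynomial (Fin 2) A) :
    substHom (M * N) p = substHom M (substHom N p) := by
  have : substHom (M * N) = (substHom M).comp (substHom N) := by
    ext j : 1
    simp only [substHom, MvPolynomial.aeval_X, AlgHom.comp_apply, map_add, map_mul,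
      MvPolynomial.aeval_C, MvPolynomial.algebraMap_eq, Matrix.mul_apply, Fin.sum_univ_two]
    ring
  rw [this, AlgHom.comp_apply]

theorem substHom_one (p : MvPolynomial (Fin 2) A) : substHom 1 p = p := by
  have : substHom (1 : Matrix (Fin 2) (Fin 2) A) = AlgHom.id A _ := by
    ext j : 1
    fin_cases j <;> simp [substHom]
  rw [this, AlgHom.id_apply]

/-- The automorphism of the polynomial ring induced by an invertible matrix. -/
noncomputable def substEquiv (M : GL (Fin 2) A) :
    MvPolynomial (Fin 2) A ≃ₐ[A] MvPolynomial (Fin 2) A :=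
  AlgEquiv.ofAlgHom (substHom M.val) (substHom M⁻¹.val)
    (AlgHom.ext fun p => by
      rw [AlgHom.comp_apply, ← substHom_mul, ← Units.val_mul, mul_inv_cancel, Units.val_one,
        substHom_one, AlgHom.id_apply])
    (AlgHom.ext fun p => by
      rw [AlgHom.comp_apply, ← substHom_mul, ← Units.val_mul, inv_mul_cancel, Units.val_one,
        substHom_one, AlgHom.id_apply])

theorem toMvPolynomial_smul (x : A) (f : BinaryCubicForm A) :
    (x • f).toMvPolynomial = MvPolynomial.C x * f.toMvPolynomial := by
  simp only [toMvPolynomial, smul_def, map_mul]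
  ring

theorem toMvPolynomial_subst (M : Matrix (Fin 2) (Fin 2) A) (f : BinaryCubicForm A) :
    (subst M f).toMvPolynomial = substHom M f.toMvPolynomial := by
  simp only [toMvPolynomial, subst, substHom, map_add, map_mul, map_pow, MvPolynomial.aeval_X,
    MvPolynomial.aeval_C, MvPolynomial.algebraMap_eq, map_ofNat]
  ring

/-- The determinant twist contributes only a unit constant, so divisibility properties pass through
the ring automorphism `substEquiv M`. -/
theorem associated_toMvPolynomial_gl_smul (M : GL (Fin 2) A) (f : BinaryCubicForm A) :
    Associated (substEquiv M f.toMvPolynomial) (M • f).toMvPolynomial := by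
  rw [gl_smul_def, toMvPolynomial_smul, toMvPolynomial_subst]
  exact (associated_unit_mul_right _ _
    ((Matrix.GeneralLinearGroup.det M)⁻¹.isUnit.map MvPolynomial.C))

theorem irreducible_gl_smul_iff (M : GL (Fin 2) A) (f : BinaryCubicForm A) :
    Irreducible (M • f).toMvPolynomial ↔ Irreducible f.toMvPolynomial := by
  rw [← (associated_toMvPolynomial_gl_smul M f).irreducible_iff,
    MulEquiv.irreducible_iff]

theorem a_ne_zero_of_irreducible {K : Type*} [Field K] {f : BinaryCubicForm K}
    (hf : Irreducible f.toMvPolynomial) : f.a ≠ 0 := by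
  intro ha
  have hfac : f.toMvPolynomial = MvPolynomial.X 1 * (MvPolynomial.C f.b * MvPolynomial.X 0 ^ 2
      + MvPolynomial.C f.c * MvPolynomial.X 0 * MvPolynomial.X 1
      + MvPolynomial.C f.d * MvPolynomial.X 1 ^ 2) := by
    simp only [toMvPolynomial, ha, map_zero]
    ring
  -- Both factors have zero constant term, so neither can be a unit.
  rcases hf.isUnit_or_isUnit hfac with h | h
  · simpa using h.map (MvPolynomial.constantCoeff (R := K) (σ := Fin 2))
  · simpa using h.map (MvPolynomial.constantCoeff (R := K) (σ := Fin 2))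

/-- A square factor p² forces p to divide both partial derivatives P and Q. Eliminating between
these two quadratics puts 3·disc·X³ and 3·disc·Y³ in the ideal (P, Q), so p divides X³ and Y³ and is
a unit. -/
theorem squarefree_of_disc_ne_zero {K : Type*} [Field K] [CharZero K] {f : BinaryCubicForm K}
    (hf : f.disc ≠ 0) : Squarefree f.toMvPolynomial := by
  rintro p ⟨k, hk⟩
  let P : MvPolynomial (Fin 2) K := MvPolynomial.C (3 * f.a) * MvPolynomial.X 0 ^ 2
    + MvPolynomial.C (2 * f.b) * MvPolynomial.X 0 * MvPolynomial.X 1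
    + MvPolynomial.C f.c * MvPolynomial.X 1 ^ 2
  let Q : MvPolynomial (Fin 2) K := MvPolynomial.C f.b * MvPolynomial.X 0 ^ 2
    + MvPolynomial.C (2 * f.c) * MvPolynomial.X 0 * MvPolynomial.X 1
    + MvPolynomial.C (3 * f.d) * MvPolynomial.X 1 ^ 2
  have hdvd (i : Fin 2) : p ∣ MvPolynomial.pderiv i f.toMvPolynomial := by
    rw [hk]
    simp only [Derivation.leibniz, smul_eq_mul]
    exact ⟨p * MvPolynomial.pderiv i k + 2 * k * MvPolynomial.pderiv i p, by ring⟩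
  have hP : p ∣ P := by
    convert hdvd 0 using 1
    simp only [P, map_mul, map_ofNat]
    simp [toMvPolynomial, MvPolynomial.pderiv_X]
    ring
  have hQ : p ∣ Q := by
    convert hdvd 1 using 1
    simp only [Q, map_mul, map_ofNat]
    simp [toMvPolynomial, MvPolynomial.pderiv_X]
    ring
  have hd : IsUnit (MvPolynomial.C (σ := Fin 2) (3 * f.disc)) :=
    (IsUnit.mk0 _ (mul_ne_zero three_ne_zero hf)).map MvPolynomial.C
  have hX : p ∣ (MvPolynomial.X 0 : MvPolynomial (Fin 2) K) ^ 3 := by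
    rw [← hd.dvd_mul_left]
    have : MvPolynomial.C (3 * f.disc) * MvPolynomial.X 0 ^ 3 =
        P * (MvPolynomial.C (6 * f.b * f.d - 2 * f.c ^ 2) *
            (MvPolynomial.X 1 * MvPolynomial.C (3 * f.d) + MvPolynomial.X 0 * MvPolynomial.C (2 * f.c))
          - MvPolynomial.C (9 * f.a * f.d - f.b * f.c) * MvPolynomial.X 0 * MvPolynomial.C (3 * f.d))
        - Q * (MvPolynomial.C (6 * f.b * f.d - 2 * f.c ^ 2) * (MvPolynomial.X 1 * MvPolynomial.C f.c
            + MvPolynomial.X 0 * MvPolynomial.C (2 * f.b))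
          - MvPolynomial.C (9 * f.a * f.d - f.b * f.c) * MvPolynomial.X 0 * MvPolynomial.C f.c) := by
      simp only [P, Q, disc, map_mul, map_add, map_sub, map_pow, map_ofNat]
      ring
    rw [this]
    exact dvd_sub (hP.mul_right _) (hQ.mul_right _)
  have hY : p ∣ (MvPolynomial.X 1 : MvPolynomial (Fin 2) K) ^ 3 := by
    rw [← hd.dvd_mul_left]
    have : MvPolynomial.C (3 * f.disc) * MvPolynomial.X 1 ^ 3 =
        P * (MvPolynomial.C (9 * f.a * f.d - f.b * f.c) * MvPolynomial.X 1 * MvPolynomial.C f.b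
          - MvPolynomial.C (6 * f.a * f.c - 2 * f.b ^ 2) * (MvPolynomial.X 0 * MvPolynomial.C f.b
            + MvPolynomial.X 1 * MvPolynomial.C (2 * f.c)))
        - Q * (MvPolynomial.C (9 * f.a * f.d - f.b * f.c) * MvPolynomial.X 1 *
            MvPolynomial.C (3 * f.a)
          - MvPolynomial.C (6 * f.a * f.c - 2 * f.b ^ 2) *
            (MvPolynomial.X 0 * MvPolynomial.C (3 * f.a) + MvPolynomial.X 1 * MvPolynomial.C (2 * f.b))) := by
      simp only [P, Q, disc, map_mul, map_add, map_sub, map_pow, map_ofNat]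
      ring
    rw [this]
    exact dvd_sub (hP.mul_right _) (hQ.mul_right _)
  obtain ⟨n, -, hn⟩ := (dvd_prime_pow MvPolynomial.X_prime 3).1 hX
  rcases Nat.eq_zero_or_pos n with rfl | hpos
  · simpa using hn
  exfalso
  have h01 : (MvPolynomial.X 0 : MvPolynomial (Fin 2) K) ∣ MvPolynomial.X 1 ^ 3 :=
    (dvd_pow_self _ hpos.ne').trans (hn.symm.dvd.trans hY)
  have := map_dvd (MvPolynomial.eval ![(0 : K), 1]) h01
  simp at this

/-- Setting Y = 1 gives a univariate cubic without roots, hence irreducible. If a factor G becomes a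
unit there, the cofactor keeps degree 3 and so uses up the whole total degree; G is then constant.
-/
theorem irreducible_of_eval_ne_zero {K : Type*} [Field K] {f : BinaryCubicForm K}
    (hf : ∀ v : Fin 2 → K, v ≠ 0 → f.eval v ≠ 0) : Irreducible f.toMvPolynomial := by
  have ha : f.a ≠ 0 := by simpa [eval] using hf ![1, 0] (by simp)
  let p : Polynomial K := Polynomial.C f.a * Polynomial.X ^ 3 + Polynomial.C f.b * Polynomial.X ^ 2
    + Polynomial.C f.c * Polynomial.X + Polynomial.C f.d
  have hdeg : p.natDegree = 3 := Polynomial.natDegree_cubic ha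
  have hp : Irreducible p := by
    refine Polynomial.irreducible_of_degree_le_three_of_not_isRoot (by simp [hdeg]) fun x hx => ?_
    refine hf ![x, 1] (by simp) ?_
    simpa [p, eval, Polynomial.IsRoot] using hx
  let φ : MvPolynomial (Fin 2) K →ₐ[K] Polynomial K := MvPolynomial.aeval ![Polynomial.X, 1]
  have hφ : φ f.toMvPolynomial = p := by
    simp [φ, p, toMvPolynomial]
  have key (G H : MvPolynomial (Fin 2) K) (hGH : f.toMvPolynomial = G * H) (hG : IsUnit (φ G)) :
      IsUnit G := by
    have hF0 : f.toMvPolynomial ≠ 0 := fun h => hp.ne_zero (by rw [← hφ, h, map_zero])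
    have hG0 : G ≠ 0 := by rintro rfl; simp_all
    have hH0 : H ≠ 0 := by rintro rfl; simp_all
    have hle (F : MvPolynomial (Fin 2) K) : (φ F).natDegree ≤ F.totalDegree := by
      simpa using! MvPolynomial.aeval_natDegree_le (n := 1) F le_rfl ![Polynomial.X, 1]
        (by intro i; fin_cases i <;> simp)
    have h3 : G.totalDegree + H.totalDegree ≤ 3 := by
      rw [← MvPolynomial.totalDegree_mul_of_isDomain hG0 hH0, ← hGH]
      have hX (i : Fin 2) (n : ℕ) :
          ((MvPolynomial.X i : MvPolynomial (Fin 2) K) ^ n).totalDegree = n :=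
        MvPolynomial.totalDegree_X_pow i n
      have hC (x : K) (g : MvPolynomial (Fin 2) K) (n : ℕ) (hg : g.totalDegree ≤ n) :
          (MvPolynomial.C x * g).totalDegree ≤ n :=
        (MvPolynomial.totalDegree_mul _ _).trans (by simpa using hg)
      have hXX (m n : ℕ) : ((MvPolynomial.X 0 : MvPolynomial (Fin 2) K) ^ m
          * MvPolynomial.X 1 ^ n).totalDegree ≤ m + n :=
        (MvPolynomial.totalDegree_mul _ _).trans (by rw [hX, hX])
      have : f.toMvPolynomial = MvPolynomial.C f.a * (MvPolynomial.X 0 ^ 3 * MvPolynomial.X 1 ^ 0)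
          + MvPolynomial.C f.b * (MvPolynomial.X 0 ^ 2 * MvPolynomial.X 1 ^ 1)
          + MvPolynomial.C f.c * (MvPolynomial.X 0 ^ 1 * MvPolynomial.X 1 ^ 2)
          + MvPolynomial.C f.d * (MvPolynomial.X 0 ^ 0 * MvPolynomial.X 1 ^ 3) := by
        simp only [toMvPolynomial]
        ring
      rw [this]
      have hadd {F G : MvPolynomial (Fin 2) K} (hF : F.totalDegree ≤ 3) (hG : G.totalDegree ≤ 3) :
          (F + G).totalDegree ≤ 3 := (MvPolynomial.totalDegree_add _ _).trans (max_le hF hG)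
      exact hadd (hadd (hadd (hC _ _ _ (hXX 3 0)) (hC _ _ _ (hXX 2 1))) (hC _ _ _ (hXX 1 2)))
        (hC _ _ _ (hXX 0 3))
    have hH : (φ H).natDegree = 3 := by
      have h := congrArg Polynomial.natDegree (show p = φ G * φ H by rw [← hφ, hGH, map_mul])
      rw [hdeg, Polynomial.natDegree_mul hG.ne_zero (fun h0 => hp.ne_zero
        (by rw [← hφ, hGH, map_mul, h0, mul_zero])), Polynomial.natDegree_eq_zero_of_isUnit hG,
        zero_add] at h
      exact h.symm
    have hG' : G.totalDegree = 0 := by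
      have := hle H
      omega
    rw [MvPolynomial.totalDegree_eq_zero_iff_eq_C] at hG'
    rw [hG'] at hG0 ⊢
    exact (IsUnit.mk0 _ fun h => hG0 (by rw [h, map_zero])).map MvPolynomial.C
  refine ⟨fun h => hp.not_isUnit (hφ ▸ h.map φ), fun G H hGH => ?_⟩
  rcases hp.isUnit_or_isUnit (show p = φ G * φ H by rw [← hφ, hGH, map_mul]) with h | h
  · exact .inl (key G H hGH h)
  · exact .inr (key H G (by rw [hGH, mul_comm]) h)

end Algebra
end BinaryCubicForm

/-! ### Real orbits, root counts and finiteness of stabilizers -/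

namespace BinaryCubicForm

theorem exists_real_root (f : BinaryCubicForm ℝ) : ∃ v : Fin 2 → ℝ, v ≠ 0 ∧ f.eval v = 0 := by
  by_contra! h
  have ha : f.a ≠ 0 := by simpa [eval] using h ![1, 0] (by simp)
  let p : Polynomial ℝ := Polynomial.C f.a * Polynomial.X ^ 3 + Polynomial.C f.b * Polynomial.X ^ 2
    + Polynomial.C f.c * Polynomial.X + Polynomial.C f.d
  have hdeg : p.natDegree = 3 := Polynomial.natDegree_cubic ha
  have hp : Irreducible p := by
    refine Polynomial.irreducible_of_degree_le_three_of_not_isRoot (by simp [hdeg]) fun x hx => ?_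
    refine h ![x, 1] (by simp) ?_
    simpa [p, eval, Polynomial.IsRoot] using hx
  have := hp.natDegree_le_two
  omega

/-- The representatives `X²Y ± Y³` of the orbits of `GL₂(ℝ)` on forms of nonzero discriminant. -/
def normalForm (ε : ℝ) : BinaryCubicForm ℝ := ⟨0, 1, 0, ε⟩

theorem gl_smul_eq_of_subst {A : Type*} [CommRing A] {M : GL (Fin 2) A} {f g : BinaryCubicForm A}
    (h : subst M.val f = M.val.det • g) : M • f = g := by
  have h' : (((Matrix.GeneralLinearGroup.det M)⁻¹ : Aˣ) : A) * M.val.det = 1 :=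
    Units.inv_mul (Matrix.GeneralLinearGroup.det M)
  rw [gl_smul_def, h]
  ext <;> simp only [smul_def, ← mul_assoc, h', one_mul]

/-- A real root is moved to [1 : 0], leaving Y times a quadratic form; completing the square and
rescaling finish the reduction. ε is the sign of bd − c²/4, where disc = −4b²(bd − c²/4). -/
theorem exists_gl_smul_eq_normalForm {f : BinaryCubicForm ℝ} (hf : f.disc ≠ 0) :
    ∃ (M : GL (Fin 2) ℝ) (ε : ℝ), (ε = 1 ∨ ε = -1) ∧ M • f = normalForm ε := by
  obtain ⟨v, hv, hv0⟩ := f.exists_real_root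
  have hN : v 0 * v 0 - v 1 * (-v 1) ≠ 0 := by
    intro h
    have h0 : v 0 = 0 := by nlinarith [sq_nonneg (v 0), sq_nonneg (v 1)]
    have h1 : v 1 = 0 := by nlinarith [sq_nonneg (v 0), sq_nonneg (v 1)]
    exact hv (by ext i; fin_cases i <;> simp [h0, h1])
  -- The first row is the root v, so M₁ᵀ(1, 0) = v and the new leading coefficient vanishes.
  let M₁ : GL (Fin 2) ℝ := Matrix.GeneralLinearGroup.mkOfDetNeZero !![v 0, v 1; -v 1, v 0]
    (by rw [Matrix.det_fin_two]; exact hN)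
  have ha₁ : (M₁ • f).a = 0 := by
    have := eval_smul M₁ f ![1, 0]
    have hv' : M₁.val.transpose.mulVec ![1, 0] = v := by
      ext i
      fin_cases i <;> simp [M₁, Matrix.GeneralLinearGroup.mkOfDetNeZero, Matrix.mulVec, dotProduct]
    rw [hv', hv0, mul_zero] at this
    simpa [eval] using this
  have hd₁ : (M₁ • f).disc ≠ 0 := by
    rw [disc_gl_smul]
    exact mul_ne_zero (pow_ne_zero _ M₁.det_ne_zero) hf
  generalize hg : M₁ • f = g at ha₁ hd₁
  obtain ⟨a, b, c, d⟩ := g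
  obtain rfl : a = 0 := ha₁
  have hb : b ≠ 0 := by
    rintro rfl
    simp [disc] at hd₁
  have he : b * d - c ^ 2 / 4 ≠ 0 := by
    intro h
    apply hd₁
    simp only [disc]
    linear_combination (-4 * b ^ 2) * h
  have hsq : √|b * d - c ^ 2 / 4| ≠ 0 := Real.sqrt_ne_zero'.2 (abs_pos.2 he)
  set ρ := √|b * d - c ^ 2 / 4| with hρ
  have hρ2 : ρ ^ 2 = |b * d - c ^ 2 / 4| := Real.sq_sqrt (abs_nonneg _)
  let M₂ : GL (Fin 2) ℝ := Matrix.GeneralLinearGroup.mkOfDetNeZero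
    !![b⁻¹, 0; -c / (2 * b * ρ), 1 / ρ] (by rw [Matrix.det_fin_two]; simp [hb, hsq])
  refine ⟨M₂ * M₁, (b * d - c ^ 2 / 4) / ρ ^ 2, ?_, ?_⟩
  · rw [hρ2]
    rcases abs_choice (b * d - c ^ 2 / 4) with h | h
    · left; rw [h, div_self he]
    · right; rw [h, div_neg, div_self he]
  · rw [mul_smul, hg]
    apply gl_smul_eq_of_subst
    have hM : M₂.val = !![b⁻¹, 0; -c / (2 * b * ρ), 1 / ρ] := rfl
    rw [hM, Matrix.det_fin_two]
    ext <;> simp [subst, smul_def, normalForm] <;> field_simp <;> ring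

theorem disc_normalForm (ε : ℝ) : (normalForm ε).disc = -4 * ε := by
  simp [disc, normalForm]

/-- The roots of a real form on the projective line. -/
def rootSet (f : BinaryCubicForm ℝ) : Set (ℙ ℝ (Fin 2 → ℝ)) := {p | f.eval p.rep = 0}

theorem mk_mem_rootSet {f : BinaryCubicForm ℝ} {v : Fin 2 → ℝ} (hv : v ≠ 0) :
    Projectivization.mk ℝ v hv ∈ f.rootSet ↔ f.eval v = 0 := by
  obtain ⟨x, hx⟩ := Projectivization.exists_smul_eq_mk_rep ℝ v hv
  rw [rootSet, mem_ofPred_eq, ← hx, Units.smul_def, eval_smul_vec]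
  simp

theorem encard_rootSet_gl_smul_le (M : GL (Fin 2) ℝ) (f : BinaryCubicForm ℝ) :
    (M • f).rootSet.encard ≤ f.rootSet.encard := by
  have hinj : Function.Injective M.val.transpose.mulVecLin := by
    rw [Matrix.coe_mulVecLin, Matrix.mulVec_injective_iff_isUnit, Matrix.isUnit_transpose]
    exact M.isUnit
  refine encard_le_encard_of_injOn (f := Projectivization.map M.val.transpose.mulVecLin hinj) ?_
    (Projectivization.map_injective _ hinj).injOn
  intro p
  induction p using Projectivization.ind with
  | h v hv =>
    intro h
    rw [mk_mem_rootSet, eval_smul] at h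
    rw [Projectivization.map_mk, mk_mem_rootSet]
    exact (mul_eq_zero.1 h).resolve_left (Units.ne_zero _)

theorem ncard_rootSet_gl_smul (M : GL (Fin 2) ℝ) (f : BinaryCubicForm ℝ) :
    (M • f).rootSet.ncard = f.rootSet.ncard := by
  refine congrArg ENat.toNat (le_antisymm (encard_rootSet_gl_smul_le M f) ?_)
  simpa using encard_rootSet_gl_smul_le M⁻¹ (M • f)

theorem ncard_rootSet_normalForm_one : (normalForm 1).rootSet.ncard = 1 := by
  rw [ncard_eq_one]
  refine ⟨Projectivization.mk ℝ ![1, 0] (by simp), ?_⟩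
  ext p
  induction p using Projectivization.ind with
  | h v hv =>
    rw [mk_mem_rootSet, mem_singleton_iff, Projectivization.mk_eq_mk_iff']
    constructor
    · intro h
      refine ⟨v 0, ?_⟩
      have h1 : v 1 = 0 := by
        by_contra h1
        have : v 1 * (v 0 ^ 2 + v 1 ^ 2) = 0 := by simp [eval, normalForm] at h; linarith
        rcases mul_eq_zero.1 this with h2 | h2
        · exact h1 h2
        · nlinarith [sq_nonneg (v 0), sq_pos_of_ne_zero h1]
      ext i; fin_cases i <;> simp [h1]
    · rintro ⟨x, rfl⟩
      simp [eval, normalForm]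

theorem ncard_rootSet_normalForm_neg_one : (normalForm (-1)).rootSet.ncard = 3 := by
  rw [ncard_eq_three]
  refine ⟨Projectivization.mk ℝ ![1, 0] (by simp), Projectivization.mk ℝ ![1, 1] (by simp),
    Projectivization.mk ℝ ![1, -1] (by simp), ?_, ?_, ?_, ?_⟩
  · rw [Ne, Projectivization.mk_eq_mk_iff']
    rintro ⟨x, hx⟩
    have h0 := congrFun hx 0
    have h1 := congrFun hx 1
    simp at h0 h1
    linarith
  · rw [Ne, Projectivization.mk_eq_mk_iff']
    rintro ⟨x, hx⟩
    have h0 := congrFun hx 0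
    have h1 := congrFun hx 1
    simp at h0 h1
    linarith
  · rw [Ne, Projectivization.mk_eq_mk_iff']
    rintro ⟨x, hx⟩
    have h0 := congrFun hx 0
    have h1 := congrFun hx 1
    simp at h0 h1
    linarith
  · ext p
    induction p using Projectivization.ind with
    | h v hv =>
      simp only [mk_mem_rootSet, mem_insert_iff, mem_singleton_iff, Projectivization.mk_eq_mk_iff']
      constructor
      · intro h
        have : v 1 * ((v 0 - v 1) * (v 0 + v 1)) = 0 := by simp [eval, normalForm] at h; linarith
        rcases mul_eq_zero.1 this with h2 | h2
        · left
          exact ⟨v 0, by ext i; fin_cases i <;> simp [h2]⟩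
        rcases mul_eq_zero.1 h2 with h2 | h2
        · right; left
          exact ⟨v 0, by ext i; fin_cases i <;> simp; linarith⟩
        · right; right
          exact ⟨v 0, by ext i; fin_cases i <;> simp; linarith⟩
      · rintro (⟨x, rfl⟩ | ⟨x, rfl⟩ | ⟨x, rfl⟩) <;> simp [eval, normalForm] <;> ring

/-- The sign of the discriminant of the forms with `r` real roots, for `r = 1, 3`. -/
def discSign (r : ℕ) : ℝ := if r = 1 then -1 else 1

/-- The action preserves the number of roots and the sign of the discriminant, so the normal forms
decide: Y(X² + Y²) has one root and discriminant −4, Y(X² − Y²) has three and discriminant 4. -/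
theorem mem_signatureSet_iff {r : ℕ} (hr : r = 1 ∨ r = 3) {f : BinaryCubicForm ℝ}
    (hf : f.disc ≠ 0) : f ∈ signatureSet r ↔ 0 < discSign r * f.disc := by
  obtain ⟨M, ε, hε, hM⟩ := exists_gl_smul_eq_normalForm hf
  have hd : M.val.det ^ 2 * f.disc = -4 * ε := by rw [← disc_gl_smul, hM, disc_normalForm]
  have hM2 : 0 < M.val.det ^ 2 := sq_pos_of_ne_zero M.det_ne_zero
  have hn : f.rootSet.ncard = (normalForm ε).rootSet.ncard := by rw [← hM, ncard_rootSet_gl_smul]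
  have : f ∈ signatureSet r ↔ f.rootSet.ncard = r :=
    ⟨fun h => h.2, fun h => ⟨squarefree_of_disc_ne_zero hf, h⟩⟩
  rw [this, hn]
  rcases hε with rfl | rfl
  · have hneg : f.disc < 0 := by
      by_contra! h
      nlinarith [mul_nonneg hM2.le h]
    rw [ncard_rootSet_normalForm_one]
    rcases hr with rfl | rfl <;> simp [discSign, hneg, hneg.le]
  · have hpos : 0 < f.disc := by
      by_contra! h
      nlinarith [mul_nonneg hM2.le (neg_nonneg.2 h)]
    rw [ncard_rootSet_normalForm_neg_one]
    rcases hr with rfl | rfl <;> simp [discSign, hpos, hpos.le]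

theorem exists_gl_smul_eq {f g : BinaryCubicForm ℝ} (h : 0 < f.disc * g.disc) :
    ∃ M : GL (Fin 2) ℝ, M • f = g := by
  obtain ⟨M, ε, hε, hM⟩ := exists_gl_smul_eq_normalForm (left_ne_zero_of_mul h.ne')
  obtain ⟨N, η, hη, hN⟩ := exists_gl_smul_eq_normalForm (right_ne_zero_of_mul h.ne')
  have h1 : M.val.det ^ 2 * f.disc = -4 * ε := by rw [← disc_gl_smul, hM, disc_normalForm]
  have h2 : N.val.det ^ 2 * g.disc = -4 * η := by rw [← disc_gl_smul, hN, disc_normalForm]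
  have h3 : 0 < (-4 * ε) * (-4 * η) := by
    rw [← h1, ← h2, mul_mul_mul_comm]
    have := M.det_ne_zero
    have := N.det_ne_zero
    positivity
  have : ε = η := by
    rcases hε with rfl | rfl <;> rcases hη with rfl | rfl <;> first | rfl | norm_num at h3
  exact ⟨N⁻¹ * M, by rw [mul_smul, hM, this, ← hN, inv_smul_smul]⟩

/-- A finite set containing the entries of all stabilizers of normal forms. -/
noncomputable def stabEntries : Finset ℝ := {0, 1, -1, 1 / 2, -1 / 2, 3 / 2, -3 / 2}

theorem mem_stabEntries_of_gl_smul_normalForm {ε : ℝ} (hε : ε = 1 ∨ ε = -1) {M : GL (Fin 2) ℝ}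
    (hM : M • normalForm ε = normalForm ε) (i j : Fin 2) : M.val i j ∈ stabEntries := by
  have h := det_smul_gl_smul M (normalForm ε)
  rw [hM] at h
  have hdet := M.det_ne_zero
  have ha := congrArg BinaryCubicForm.a h
  have hb := congrArg BinaryCubicForm.b h
  have hc := congrArg BinaryCubicForm.c h
  have hd := congrArg BinaryCubicForm.d h
  simp only [smul_def, subst, normalForm, Matrix.det_fin_two] at ha hb hc hd
  have hdet' : M.val 0 0 * M.val 1 1 - M.val 0 1 * M.val 1 0 ≠ 0 := by
    rw [← Matrix.det_fin_two]; exact M.det_ne_zero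
  have hall : (M.val 0 0 ∈ stabEntries ∧ M.val 0 1 ∈ stabEntries) ∧
      (M.val 1 0 ∈ stabEntries ∧ M.val 1 1 ∈ stabEntries) := by
    generalize M.val 0 0 = p at *
    generalize M.val 0 1 = q at *
    generalize M.val 1 0 = u at *
    generalize M.val 1 1 = v at *
    -- The row (p, q) must be a root of the normal form: either [1 : 0] itself, or, only when ε =
    -- −1, one of [1 : ±1].
    have hq : q = 0 ∨ p ^ 2 + ε * q ^ 2 = 0 := by
      rw [← mul_eq_zero]; linarith
    rcases hq with rfl | hq
    · have hp : p ≠ 0 := by rintro rfl; simp at hdet'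
      have hv : v ≠ 0 := by rintro rfl; simp at hdet'
      have hp1 : p = 1 := mul_left_cancel₀ (mul_ne_zero hp hv) (by linarith)
      subst hp1
      have hu : u = 0 := mul_left_cancel₀ hv (by linarith)
      have hε0 : ε ≠ 0 := by rcases hε with rfl | rfl <;> norm_num
      have hv1 : (v - 1) * (v + 1) = 0 :=
        mul_left_cancel₀ (mul_ne_zero hε0 hv) (by rw [hu] at hd; linarith)
      rcases mul_eq_zero.1 hv1 with h | h
      · obtain rfl : v = 1 := by linarith
        simp [stabEntries, hu]
      · obtain rfl : v = -1 := by linarith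
        simp [stabEntries, hu]
    · by_cases hq0 : q = 0
      · subst hq0
        have : p = 0 := by nlinarith
        subst this
        simp at hdet'
      have hε1 : ε = -1 := by
        rcases hε with rfl | rfl
        · nlinarith [sq_nonneg p, sq_pos_of_ne_zero hq0]
        · rfl
      subst hε1
      obtain ⟨σ, hσ, rfl⟩ : ∃ σ : ℝ, (σ = 1 ∨ σ = -1) ∧ p = σ * q := by
        have : (p - q) * (p + q) = 0 := by linarith
        rcases mul_eq_zero.1 this with h | h
        · exact ⟨1, .inl rfl, by linarith⟩
        · exact ⟨-1, .inr rfl, by linarith⟩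
      have hσ2 : σ ^ 2 = 1 := by rcases hσ with rfl | rfl <;> norm_num
      have hw : σ * v - u ≠ 0 := fun h => hdet' (by linear_combination q * h)
      have hq1 : -2 * σ * q = 1 := by
        apply mul_left_cancel₀ (mul_ne_zero hq0 hw)
        linear_combination -hb - 3 * q ^ 2 * v * hσ2
      have hu : u = -3 * σ * v := by
        have : q * (σ * v - u) * (u + 3 * σ * v) = 0 := by
          linear_combination hc + 3 * q * v ^ 2 * hσ2
        have := (mul_eq_zero.1 this).resolve_left (mul_ne_zero hq0 hw)
        linarith
      subst hu
      have hv : v ≠ 0 := by rintro rfl; simp at hw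
      have hv1 : (2 * v - 1) * (2 * v + 1) = 0 := by
        apply mul_left_cancel₀ hv
        rcases hσ with rfl | rfl <;> linear_combination (-1 / 2) * hd + v * hq1
      have hq2 : q = -σ / 2 := by
        rcases hσ with rfl | rfl <;> linarith
      subst hq2
      rcases mul_eq_zero.1 hv1 with h | h
      · obtain rfl : v = 1 / 2 := by linarith
        rcases hσ with rfl | rfl <;> norm_num [stabEntries]
      · obtain rfl : v = -1 / 2 := by linarith
        rcases hσ with rfl | rfl <;> norm_num [stabEntries]
  fin_cases i <;> fin_cases j
  exacts [hall.1.1, hall.1.2, hall.2.1, hall.2.2]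

/-- Conjugation over ℝ embeds the stabilizer into that of a normal form, whose matrix entries lie in
a fixed finite set. That the bound does not depend on f is what a success probability uniform in T
requires. -/
theorem finite_stabilizer_and_card_le {f : BinaryCubicForm ℤ} (hf : f.toReal.disc ≠ 0) :
    Finite (MulAction.stabilizer (GL (Fin 2) ℤ) f) ∧
      Nat.card (MulAction.stabilizer (GL (Fin 2) ℤ) f) ≤ Nat.card (Fin 2 → Fin 2 → stabEntries) := by
  obtain ⟨M, ε, hε, hM⟩ := exists_gl_smul_eq_normalForm hf
  have hstab (γ : MulAction.stabilizer (GL (Fin 2) ℤ) f) :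
      (M * Matrix.GeneralLinearGroup.map (Int.castRingHom ℝ) γ.1 * M⁻¹) • normalForm ε
        = normalForm ε := by
    rw [← hM, mul_smul, mul_smul, inv_smul_smul, toReal, ← map_gl_smul, γ.2]
  let φ : MulAction.stabilizer (GL (Fin 2) ℤ) f → Fin 2 → Fin 2 → stabEntries := fun γ i j =>
    ⟨_, mem_stabEntries_of_gl_smul_normalForm hε (hstab γ) i j⟩
  have hφ : Function.Injective φ := by
    intro γ δ h
    have h1 : M * Matrix.GeneralLinearGroup.map (Int.castRingHom ℝ) γ.1 * M⁻¹
        = M * Matrix.GeneralLinearGroup.map (Int.castRingHom ℝ) δ.1 * M⁻¹ := by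
      ext i j
      exact congrArg Subtype.val (congrFun (congrFun h i) j)
    have h2 := mul_left_cancel (mul_right_cancel h1)
    apply Subtype.ext
    ext i j
    have h3 := congrArg (fun N : GL (Fin 2) ℝ => N.val i j) h2
    simpa [Matrix.GeneralLinearGroup.map_apply] using h3
  exact ⟨Finite.of_injective φ hφ, Nat.card_le_card_of_injective φ hφ⟩

/-! ### Integral forms: irreducibility modulo 2 and invariance of the target set -/

theorem irreducibleOverRat_gl_smul_iff (γ : GL (Fin 2) ℤ) (f : BinaryCubicForm ℤ) :
    (γ • f).IrreducibleOverRat ↔ f.IrreducibleOverRat := by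
  rw [IrreducibleOverRat, map_gl_smul, irreducible_gl_smul_iff, IrreducibleOverRat]

theorem IrreducibleOverRat.a_ne_zero {f : BinaryCubicForm ℤ} (hf : f.IrreducibleOverRat) :
    f.a ≠ 0 := fun h => a_ne_zero_of_irreducible hf (by simp [map, h])

/-- Modulo 2 the form takes the value 1 at all three points of ℙ¹(𝔽₂), and a coprime pair does not
reduce to (0, 0). -/
theorem eval_intCast_ne_zero_of_odd {f : BinaryCubicForm ℤ} (ha : Odd f.a) (hd : Odd f.d)
    (hbc : Odd (f.b + f.c)) {x y : ℤ} (hxy : IsCoprime x y) : f.eval ![x, y] ≠ 0 := by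
  intro h
  have key : ∀ a b c d x y : ZMod 2, a = 1 → d = 1 → b + c = 1 →
      a * x ^ 3 + b * x ^ 2 * y + c * x * y ^ 2 + d * y ^ 3 = 0 → x = 0 ∧ y = 0 := by decide
  have h2 := congrArg (Int.cast : ℤ → ZMod 2) h
  simp only [eval, Matrix.cons_val_zero, Matrix.cons_val_one, Int.cast_add, Int.cast_mul,
    Int.cast_pow, Int.cast_zero] at h2
  obtain ⟨hx, hy⟩ := key f.a f.b f.c f.d x y ((ZMod.intCast_eq_one_iff_odd).2 ha)
    ((ZMod.intCast_eq_one_iff_odd).2 hd)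
    (by rw [← Int.cast_add]; exact (ZMod.intCast_eq_one_iff_odd).2 hbc) h2
  rw [ZMod.intCast_zmod_eq_zero_iff_dvd] at hx hy
  have := hxy.isUnit_of_dvd' hx hy
  rw [Int.isUnit_iff] at this
  omega

theorem irreducibleOverRat_of_odd {f : BinaryCubicForm ℤ} (ha : Odd f.a) (hd : Odd f.d)
    (hbc : Odd (f.b + f.c)) : f.IrreducibleOverRat := by
  apply irreducible_of_eval_ne_zero
  intro v hv h
  by_cases h1 : v 1 = 0
  · have h0 : v 0 ≠ 0 := fun h0 => hv (by ext i; fin_cases i <;> simp [h0, h1])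
    have ha0 : f.a ≠ 0 := by rintro h; simp [h] at ha
    simp [eval, h1, h0, map, ha0] at h
  · set x : ℚ := v 0 / v 1 with hx
    apply eval_intCast_ne_zero_of_odd ha hd hbc (x := x.num) (y := x.den)
      (Int.isCoprime_iff_gcd_eq_one.2 x.reduced)
    have hv0 : v 0 = x * v 1 := by rw [hx]; field_simp
    have hden : (x.den : ℚ) ≠ 0 := by exact_mod_cast x.den_nz
    have hnum : (x.num : ℚ) = x * x.den := (Rat.mul_den_eq_num x).symm
    have : ((f.eval ![x.num, (x.den : ℤ)] : ℤ) : ℚ) = 0 := by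
      simp only [eval, map, hv0, eq_intCast] at h
      simp only [eval, Matrix.cons_val_zero, Matrix.cons_val_one]
      push_cast
      rw [hnum]
      have h' : v 1 ^ 3 * ((f.a : ℚ) * x ^ 3 + f.b * x ^ 2 + f.c * x + f.d) = 0 := by
        linear_combination h
      have h'' := (mul_eq_zero.1 h').resolve_left (pow_ne_zero 3 h1)
      linear_combination (x.den : ℚ) ^ 3 * h''
    exact_mod_cast this

theorem toReal_gl_smul (γ : GL (Fin 2) ℤ) (f : BinaryCubicForm ℤ) :
    (γ • f).toReal = Matrix.GeneralLinearGroup.map (Int.castRingHom ℝ) γ • f.toReal :=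
  map_gl_smul _ γ f

theorem det_map_sq (γ : GL (Fin 2) ℤ) :
    (Matrix.GeneralLinearGroup.map (Int.castRingHom ℝ) γ).val.det ^ 2 = 1 := by
  have h : (Matrix.GeneralLinearGroup.map (Int.castRingHom ℝ) γ).val.det = (γ.val.det : ℝ) :=
    (RingHom.map_det (Int.castRingHom ℝ) γ.val).symm
  rw [h]
  have : γ.val.det ^ 2 = 1 := by
    rcases Int.isUnit_iff.1 ((Matrix.isUnit_iff_isUnit_det _).1 γ.isUnit) with h | h <;>
      rw [h] <;> rfl
  exact_mod_cast this

theorem disc_toReal_gl_smul (γ : GL (Fin 2) ℤ) (f : BinaryCubicForm ℤ) :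
    (γ • f).toReal.disc = f.toReal.disc := by
  rw [toReal_gl_smul, disc_gl_smul, det_map_sq, one_mul]

theorem isTarget_gl_smul_iff {r : ℕ} (hr : r = 1 ∨ r = 3) (T : ℝ) (γ : GL (Fin 2) ℤ)
    (f : BinaryCubicForm ℤ) : IsTarget r T (γ • f) ↔ IsTarget r T f := by
  simp only [IsTarget, irreducibleOverRat_gl_smul_iff, disc_toReal_gl_smul]
  by_cases h : f.toReal.disc = 0
  · simp [h]
  · rw [mem_signatureSet_iff hr h, mem_signatureSet_iff hr (by rwa [disc_toReal_gl_smul]),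
      disc_toReal_gl_smul]

end BinaryCubicForm

/-! ### The height covariant on the upper half-plane -/

namespace BinaryCubicForm

open UpperHalfPlane ComplexConjugate

/-- Three times the symmetric trilinear form attached to `f`, evaluated at `(z, -1)` twice and at
`(w, -1)` once. -/
def polar (f : BinaryCubicForm ℝ) (z w : ℂ) : ℂ :=
  3 * f.a * z ^ 2 * w - f.b * (z ^ 2 + 2 * z * w) + f.c * (w + 2 * z) - 3 * f.d

theorem polar_conj (f : BinaryCubicForm ℝ) (z w : ℂ) :
    f.polar (conj z) (conj w) = conj (f.polar z w) := by
  simp only [polar, map_sub, map_add, map_mul, map_pow, Complex.conj_ofReal, map_ofNat]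

/-- The action of `GL₂` by conjugation with the permutation matrix. -/
def twist {A : Type*} [CommRing A] : GL (Fin 2) A ≃* GL (Fin 2) A :=
  Units.mapEquiv (Matrix.reindexRingEquiv A (Equiv.swap (0 : Fin 2) 1)).toMulEquiv

theorem twist_val {A : Type*} [CommRing A] (M : GL (Fin 2) A) :
    (twist M).val = !![M.val 1 1, M.val 1 0; M.val 0 1, M.val 0 0] := by
  ext i j
  fin_cases i <;> fin_cases j <;> rfl

theorem det_twist {A : Type*} [CommRing A] (M : GL (Fin 2) A) :
    (twist M).val.det = M.val.det := by
  simp only [twist_val, Matrix.det_fin_two]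
  simp
  ring

theorem map_twist {A B : Type*} [CommRing A] [CommRing B] (φ : A →+* B) (M : GL (Fin 2) A) :
    Matrix.GeneralLinearGroup.map φ (twist M) = twist (Matrix.GeneralLinearGroup.map φ M) := by
  ext i j
  fin_cases i <;> fin_cases j <;> rfl

/-- If z' is the Möbius image of z under `twist M`, then Mᵀ(z', −1) is det M / denom times (z, −1).
Trilinearity yields det³ over the three denominators, and the twist by det⁻¹ leaves det². -/
theorem polar_gl_smul (M : GL (Fin 2) ℝ) (f : BinaryCubicForm ℝ) {z w : ℂ}
    (hz : denom (twist M) z ≠ 0) (hw : denom (twist M) w ≠ 0) :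
    (M • f).polar (num (twist M) z / denom (twist M) z) (num (twist M) w / denom (twist M) w)
      = (M.val.det : ℂ) ^ 2 / (denom (twist M) z ^ 2 * denom (twist M) w) * f.polar z w := by
  have hdet : (M.val.det : ℂ) ≠ 0 := by exact_mod_cast M.det_ne_zero
  apply mul_left_cancel₀ hdet
  have hsub : (M.val.det : ℂ) * (M • f).polar (num (twist M) z / denom (twist M) z)
      (num (twist M) w / denom (twist M) w) = (subst M.val f).polar
      (num (twist M) z / denom (twist M) z) (num (twist M) w / denom (twist M) w) := by
    rw [← det_smul_gl_smul M f]
    simp only [polar, smul_def]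
    push_cast
    ring
  rw [hsub]
  have h1 (z : ℂ) : num (twist M) z = M.val 1 1 * z + M.val 1 0 := by simp [num, twist_val]
  have h2 (z : ℂ) : denom (twist M) z = M.val 0 1 * z + M.val 0 0 := by simp [denom, twist_val]
  rw [h2] at hz hw
  rw [Matrix.det_fin_two]
  simp only [h1, h2, polar, subst]
  push_cast
  generalize (M.val 0 0 : ℂ) = p at *
  generalize (M.val 0 1 : ℂ) = q at *
  generalize (M.val 1 0 : ℂ) = u at *
  generalize (M.val 1 1 : ℂ) = v at *
  field_simp
  ring

/-- The value of `q` at `g⁻¹ f`, where `g = n(t) a(s)` and `τ = t + i s²`. -/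
noncomputable def height (f : BinaryCubicForm ℝ) (τ : ℍ) : ℝ :=
  (Complex.normSq (f.polar τ τ) / 9 + Complex.normSq (f.polar τ (conj (τ : ℂ))))
    / (2 * τ.im ^ 3)

/-- The squared norms scale by det⁴/|denom|⁶ and im³ by |det|³/|denom|⁶, leaving |det|. -/
theorem height_gl_smul (M : GL (Fin 2) ℝ) (f : BinaryCubicForm ℝ) (τ : ℍ) :
    (M • f).height (twist M • τ) = |M.val.det| * f.height τ := by
  have hd := denom_ne_zero (twist M) τ
  have hconj : denom (twist M) (conj (τ : ℂ)) = conj (denom (twist M) τ) := by simp [denom]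
  have hnconj : num (twist M) (conj (τ : ℂ)) = conj (num (twist M) τ) := by simp [num]
  have hd' : denom (twist M) (conj (τ : ℂ)) ≠ 0 := by
    rw [hconj]; simp [hd]
  have hD : ((twist M).det.val : ℝ) = M.val.det := det_twist M
  have hn : 0 < Complex.normSq (denom (twist M) τ) := Complex.normSq_pos.2 hd
  have hmob (z w : ℂ) (hz : denom (twist M) z ≠ 0) (hw : denom (twist M) w ≠ 0) :
      Complex.normSq ((M • f).polar (num (twist M) z / denom (twist M) z)
        (num (twist M) w / denom (twist M) w))
      = |M.val.det| ^ 4 / (Complex.normSq (denom (twist M) z) ^ 2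
        * Complex.normSq (denom (twist M) w)) * Complex.normSq (f.polar z w) := by
    rw [polar_gl_smul M f hz hw]
    simp only [map_mul, map_div₀, map_pow, Complex.normSq_ofReal]
    rw [← sq, ← pow_mul, ← Even.pow_abs (by decide : Even (2 * 2))]
  have e1 : Complex.normSq ((M • f).polar ↑(twist M • τ) ↑(twist M • τ))
      = |M.val.det| ^ 4 / Complex.normSq (denom (twist M) τ) ^ 3
        * Complex.normSq (f.polar τ τ) := by
    rw [coe_smul, σ]
    -- The cases are the signs of the determinant; for negative determinant the action includes
    -- complex conjugation, absorbed by `polar_conj`.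
    split_ifs
    · rw [ContinuousAlgEquiv.refl_apply, hmob _ _ hd hd]
      ring
    · simp only [Complex.conjCAE_apply, map_div₀, ← hconj, ← hnconj]
      rw [hmob _ _ hd' hd', hconj, polar_conj, Complex.normSq_conj, Complex.normSq_conj]
      ring
  have e2 : Complex.normSq ((M • f).polar ↑(twist M • τ) (conj (↑(twist M • τ) : ℂ)))
      = |M.val.det| ^ 4 / Complex.normSq (denom (twist M) τ) ^ 3
        * Complex.normSq (f.polar τ (conj (τ : ℂ))) := by
    rw [coe_smul, σ]
    split_ifs
    · simp only [ContinuousAlgEquiv.refl_apply, map_div₀, ← hconj, ← hnconj]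
      rw [hmob _ _ hd hd', hconj, Complex.normSq_conj]
      ring
    · simp only [Complex.conjCAE_apply, map_div₀, ← hconj, ← hnconj]
      rw [hconj, hnconj, Complex.conj_conj, Complex.conj_conj, ← hconj, ← hnconj,
        hmob _ _ hd' hd, hconj, Complex.normSq_conj, ← Complex.normSq_conj (f.polar _ _),
        ← polar_conj, Complex.conj_conj]
      ring
  have hy := τ.im_pos
  have hdet : 0 < |M.val.det| := abs_pos.2 M.det_ne_zero
  rw [height, height, e1, e2, im_smul_eq_div_normSq, hD]
  field_simp

/-- The point `t + i s²` of the upper half-plane. -/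
noncomputable def point (t s : ℝ) (hs : 0 < s) : ℍ := ⟨⟨t, s ^ 2⟩, by positivity⟩

theorem height_I (f : BinaryCubicForm ℝ) : f.height I = f.q := by
  simp only [height, polar, q, Complex.normSq_apply]
  simp [pow_two]
  ring

theorem val_nMat_mul_aMat (t : ℝ) {s : ℝ} (hs : 0 < s) :
    (CubicSampling.nMat t * CubicSampling.aMat s).val = !![s⁻¹, 0; t * s⁻¹, s] := by
  rw [Units.val_mul, CubicSampling.aMat, dif_pos hs.ne']
  simp [CubicSampling.nMat, Matrix.GeneralLinearGroup.mkOfDetNeZero]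

theorem twist_smul_I (t : ℝ) {s : ℝ} (hs : 0 < s) :
    twist (CubicSampling.nMat t * CubicSampling.aMat s) • I = point t s hs := by
  have hdet : (twist (CubicSampling.nMat t * CubicSampling.aMat s)).val.det = 1 := by
    rw [det_twist, val_nMat_mul_aMat t hs, Matrix.det_fin_two]
    simp [hs.ne']
  apply UpperHalfPlane.ext
  rw [coe_smul_of_det_pos (by rw [Matrix.GeneralLinearGroup.val_det_apply, hdet]; exact one_pos)]
  have hs' : (s : ℂ) ≠ 0 := by exact_mod_cast hs.ne'
  have hp : (point t s hs : ℂ) = t + s ^ 2 * Complex.I := by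
    apply Complex.ext <;> simp [point, ← Complex.ofReal_pow]
  rw [hp, num, denom, twist_val, val_nMat_mul_aMat t hs]
  simp
  field_simp
  ring

/-- By covariance it is enough to compare at i, where the height is q: the matrix n(t)a(s) has
determinant 1 and carries i to t + is². -/
theorem height_point (f : BinaryCubicForm ℝ) (t : ℝ) {s : ℝ} (hs : 0 < s) :
    f.height (point t s hs) = q ((CubicSampling.nMat t * CubicSampling.aMat s)⁻¹ • f) := by
  have hdet : (CubicSampling.nMat t * CubicSampling.aMat s).val.det = 1 := by
    rw [val_nMat_mul_aMat t hs, Matrix.det_fin_two]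
    simp [hs.ne']
  rw [← height_I, ← twist_smul_I t hs, ← one_mul (height _ I), ← abs_one, ← hdet,
    ← height_gl_smul, smul_inv_smul]

theorem q_smul (x : ℝ) (f : BinaryCubicForm ℝ) : q (x • f) = x ^ 2 * q f := by
  simp only [q, smul_def]
  ring

theorem mem_smul_unitBall_iff (f : BinaryCubicForm ℝ) {ρ : ℝ} (hρ : 0 < ρ) (t : ℝ) {s : ℝ}
    (hs : 0 < s) :
    f ∈ ρ • (CubicSampling.nMat t * CubicSampling.aMat s) • unitBall
      ↔ f.height (point t s hs) < ρ ^ 2 := by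
  rw [height_point]
  generalize CubicSampling.nMat t * CubicSampling.aMat s = g
  have hmem (f : BinaryCubicForm ℝ) : f ∈ unitBall ↔ q f < 1 := by
    rw [unitBall, mem_ofPred_eq, Real.sqrt_lt' one_pos, one_pow]
  have h1 (x y : ℝ) (f : BinaryCubicForm ℝ) : x • y • f = (x * y) • f := by
    ext <;> simp only [smul_def, mul_assoc]
  have h2 (f : BinaryCubicForm ℝ) : (1 : ℝ) • f = f := by ext <;> simp [smul_def]
  constructor
  · rintro ⟨_, ⟨f, hf, rfl⟩, rfl⟩
    simp only
    rw [smul_smul_comm, inv_smul_smul, q_smul]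
    nlinarith [(hmem f).1 hf, pow_pos hρ 2]
  · intro h
    refine ⟨ρ⁻¹ • f, ⟨g⁻¹ • ρ⁻¹ • f, ?_, smul_inv_smul _ _⟩, ?_⟩
    · rw [hmem, smul_smul_comm, q_smul, inv_pow, inv_mul_lt_iff₀ (by positivity), mul_one]
      exact h
    · simp only
      rw [h1, mul_inv_cancel₀ hρ.ne', h2]

/-- The points of the upper half-plane at which the height of `f` is small relative to its
discriminant. -/
def lowSet (R : ℝ) (f : BinaryCubicForm ℝ) : Set ℍ := {τ | f.height τ < R ^ 2 * √|f.disc|}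

/-- Both sides of the defining inequality are multiplied by |det M|. -/
theorem smul_mem_lowSet_iff (R : ℝ) (M : GL (Fin 2) ℝ) (f : BinaryCubicForm ℝ) (τ : ℍ) :
    twist M • τ ∈ lowSet R (M • f) ↔ τ ∈ lowSet R f := by
  rw [lowSet, lowSet, mem_ofPred_eq, mem_ofPred_eq, height_gl_smul, disc_gl_smul, abs_mul, abs_pow,
    Real.sqrt_mul (by positivity), Real.sqrt_sq (abs_nonneg _), mul_left_comm]
  exact mul_lt_mul_iff_right₀ (abs_pos.2 M.det_ne_zero)

theorem continuous_height (f : BinaryCubicForm ℝ) : Continuous f.height := by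
  unfold height polar
  refine Continuous.div (by fun_prop) (by fun_prop) fun τ => ?_
  have := τ.im_pos
  positivity

theorem isOpen_lowSet (R : ℝ) (f : BinaryCubicForm ℝ) : IsOpen (lowSet R f) :=
  isOpen_lt f.continuous_height continuous_const

theorem volume_lowSet_gl_smul (R : ℝ) (M : GL (Fin 2) ℝ) (f : BinaryCubicForm ℝ) :
    volume (lowSet R (M • f)) = volume (lowSet R f) := by
  rw [← measure_preimage_smul volume (twist M) (lowSet R (M • f))]
  congr 1
  ext τ
  exact smul_mem_lowSet_iff R M f τ

theorem volume_lowSet_eq (R : ℝ) {f g : BinaryCubicForm ℝ} (h : 0 < f.disc * g.disc) :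
    volume (lowSet R f) = volume (lowSet R g) := by
  obtain ⟨M, rfl⟩ := exists_gl_smul_eq h
  rw [volume_lowSet_gl_smul]

end BinaryCubicForm

/-! ### Unfolding over GL₂(ℤ) -/

namespace ModularGroup

open UpperHalfPlane Modular MatrixGroups

/-- The image of an integral matrix in `GL₂(ℝ)`. -/
noncomputable def toGLReal : GL (Fin 2) ℤ →* GL (Fin 2) ℝ :=
  Matrix.GeneralLinearGroup.map (Int.castRingHom ℝ)

theorem toGLReal_val (γ : GL (Fin 2) ℤ) (i j : Fin 2) : (toGLReal γ).val i j = γ.val i j := rfl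

theorem toGLReal_neg (γ : GL (Fin 2) ℤ) : toGLReal (-γ) = -toGLReal γ := by
  ext i j
  simp [toGLReal_val]

/-- The reflection `diag(-1, 1)`. -/
def reflection : GL (Fin 2) ℤ where
  val := !![-1, 0; 0, 1]
  inv := !![-1, 0; 0, 1]
  val_inv := by ext i j; fin_cases i <;> fin_cases j <;> simp
  inv_val := by ext i j; fin_cases i <;> fin_cases j <;> simp

theorem toGLReal_reflection_smul (τ : ℍ) : toGLReal reflection • τ = J • τ := by
  congr 1
  ext i j
  fin_cases i <;> fin_cases j <;> simp [toGLReal_val, reflection]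

theorem reflection_smul_mem_fdo {τ : ℍ} (h : τ ∈ 𝒟ᵒ) : toGLReal reflection • τ ∈ 𝒟ᵒ := by
  rw [toGLReal_reflection_smul]
  have hre : (J • τ).re = -τ.re := by
    rw [← coe_re, coe_J_smul]; simp
  refine ⟨?_, ?_⟩
  · rw [coe_J_smul]
    simpa using h.1
  · rw [hre, abs_neg]
    exact h.2

theorem sl_smul_eq {g : SL(2, ℤ)} {γ : GL (Fin 2) ℤ} (h : γ.val = g.val) (τ : ℍ) :
    g • τ = toGLReal γ • τ := by
  rw [sl_moeb]
  congr 1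
  ext i j
  rw [toGLReal_val, h]
  rfl

/-- Determinant 1 is the classical statement for SL₂(ℤ). Determinant −1 reduces to it by composing
with τ ↦ −τ̄, which preserves 𝒟ᵒ. -/
theorem toGLReal_smul_mem_fdo_iff {τ : ℍ} (h : τ ∈ 𝒟ᵒ) (γ : GL (Fin 2) ℤ) :
    toGLReal γ • τ ∈ 𝒟ᵒ ↔ γ ∈ ({1, -1, reflection, -reflection} : Finset (GL (Fin 2) ℤ)) := by
  have hsl (γ : GL (Fin 2) ℤ) (hdet : γ.val.det = 1) (hγ : toGLReal γ • τ ∈ 𝒟ᵒ) :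
      γ = 1 ∨ γ = -1 := by
    let g : SL(2, ℤ) := ⟨γ.val, hdet⟩
    have := eq_one_or_neg_one_of_mem_fdo_mem_fdo (g := g) h (by rwa [sl_smul_eq (γ := γ) rfl])
    refine this.imp (fun hg => ?_) (fun hg => ?_)
    · exact Units.ext (congrArg Subtype.val hg)
    · exact Units.ext (by simpa [g] using congrArg Subtype.val hg)
  constructor
  · intro hγ
    simp only [Finset.mem_insert, Finset.mem_singleton]
    rcases Int.isUnit_iff.1 ((Matrix.isUnit_iff_isUnit_det _).1 γ.isUnit) with hd | hd
    · rcases hsl γ hd hγ with h | h <;> simp [h]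
    · have h1 := hsl (reflection * γ) (by
        rw [Units.val_mul, Matrix.det_mul, hd]; simp [reflection]) (by
        rw [map_mul, mul_smul]; exact reflection_smul_mem_fdo hγ)
      have hr : reflection * reflection = 1 := Units.ext reflection.val_inv
      have hγ' : γ = reflection * (reflection * γ) := by rw [← mul_assoc, hr, one_mul]
      rcases h1 with h1 | h1 <;> rw [h1] at hγ' <;> simp [hγ']
  · intro hγ
    simp only [Finset.mem_insert, Finset.mem_singleton] at hγ
    rcases hγ with rfl | rfl | rfl | rfl
    · simpa using h
    · rw [toGLReal_neg, UpperHalfPlane.neg_smul]; simpa using h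
    · exact reflection_smul_mem_fdo h
    · rw [toGLReal_neg, UpperHalfPlane.neg_smul]; exact reflection_smul_mem_fdo h

theorem card_fdo_stabilizers :
    ({1, -1, reflection, -reflection} : Finset (GL (Fin 2) ℤ)).card = 4 := by
  have h (a b : GL (Fin 2) ℤ) (i : Fin 2) (hi : a.val i i ≠ b.val i i) : a ≠ b := by
    rintro rfl; exact hi rfl
  rw [Finset.card_insert_of_notMem, Finset.card_insert_of_notMem, Finset.card_insert_of_notMem,
    Finset.card_singleton]
  · simpa using h reflection (-reflection) 0 (by simp [reflection])
  · simp only [Finset.mem_insert, Finset.mem_singleton, not_or]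
    exact ⟨h (-1) reflection 1 (by simp [reflection]),
      h (-1) (-reflection) 0 (by simp [reflection])⟩
  · simp only [Finset.mem_insert, Finset.mem_singleton, not_or]
    exact ⟨h 1 (-1) 0 (by simp), h 1 reflection 0 (by simp [reflection]),
      h 1 (-reflection) 1 (by simp [reflection])⟩

theorem volume_fd_diff_fdo : volume (𝒟 \ 𝒟ᵒ) = 0 := by
  rw [volume_eq_lintegral]
  apply setLIntegral_measure_zero
  have hre (x : ℝ) : volume {z : ℂ | z.re = x} = 0 := by
    have : {z : ℂ | z.re = x} = Complex.measurableEquivRealProd ⁻¹' ({x} ×ˢ univ) := by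
      ext z; simp
    rw [this, Complex.volume_preserving_equiv_real_prod.measure_preimage_equiv,
      Measure.volume_eq_prod, Measure.prod_prod]
    simp
  have hsub : (UpperHalfPlane.coe '' (𝒟 \ 𝒟ᵒ)) ⊆
      ({z : ℂ | z.re = 1 / 2} ∪ {z : ℂ | z.re = -1 / 2}) ∪ Metric.sphere 0 1 := by
    rintro _ ⟨τ, ⟨h1, h2⟩, rfl⟩
    by_cases hn : 1 < Complex.normSq (τ : ℂ)
    · left
      have h3 : |τ.re| = 1 / 2 := le_antisymm h1.2 (not_lt.1 fun h => h2 ⟨hn, h⟩)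
      rcases (abs_eq (by norm_num)).1 h3 with h | h
      · exact .inl h
      · exact .inr (by rw [mem_ofPred_eq, coe_re, h]; ring)
    · right
      have : Complex.normSq (τ : ℂ) = 1 := le_antisymm (not_lt.1 hn) h1.1
      rw [Complex.normSq_eq_norm_sq, pow_eq_one_iff_of_nonneg (norm_nonneg _) two_ne_zero] at this
      simpa using this
  refine measure_mono_null hsub ?_
  simp only [measure_union_null_iff, hre, Measure.addHaar_sphere, and_self]

instance : Countable (GL (Fin 2) ℤ) :=
  haveI : Countable (Matrix (Fin 2) (Fin 2) ℤ) := inferInstanceAs (Countable (Fin 2 → Fin 2 → ℤ))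
  Units.val_injective.countable

open Classical in
-- Outside the countably many translates of the null boundary of 𝒟, a point is moved into 𝒟ᵒ by some
-- γ₀; the elements doing so are then the four multiples of γ₀ by self-maps of 𝒟ᵒ.
theorem tsum_indicator_fdo_smul :
    ∀ᵐ τ : ℍ, ∑' γ : GL (Fin 2) ℤ, 𝒟ᵒ.indicator (fun _ => (1 : ℝ≥0∞)) (toGLReal γ • τ) = 4 := by
  have hae : ∀ᵐ τ : ℍ, ∀ γ : GL (Fin 2) ℤ, toGLReal γ • τ ∉ 𝒟 \ 𝒟ᵒ := by
    rw [ae_all_iff]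
    intro γ
    rw [ae_iff]
    simp only [not_not]
    change volume ((fun τ => toGLReal γ • τ) ⁻¹' (𝒟 \ 𝒟ᵒ)) = 0
    rw [measure_preimage_smul, volume_fd_diff_fdo]
  filter_upwards [hae] with τ hτ
  obtain ⟨g, hg⟩ := exists_smul_mem_fd τ
  let γ₀ : GL (Fin 2) ℤ := ⟨g.val, g⁻¹.val, congrArg Subtype.val (mul_inv_cancel g),
    congrArg Subtype.val (inv_mul_cancel g)⟩
  rw [sl_smul_eq (γ := γ₀) rfl] at hg
  have hz : toGLReal γ₀ • τ ∈ 𝒟ᵒ := by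
    by_contra h
    exact hτ γ₀ ⟨hg, h⟩
  rw [← (Equiv.mulRight γ₀).tsum_eq]
  have : ∀ γ : GL (Fin 2) ℤ, 𝒟ᵒ.indicator (fun _ => (1 : ℝ≥0∞))
      (toGLReal (Equiv.mulRight γ₀ γ) • τ) =
      if γ ∈ ({1, -1, reflection, -reflection} : Finset (GL (Fin 2) ℤ)) then 1 else 0 := by
    intro γ
    rw [Equiv.coe_mulRight, map_mul, mul_smul, indicator_apply]
    simp only [toGLReal_smul_mem_fdo_iff hz]
  rw [tsum_congr this, tsum_eq_sum (s := {1, -1, reflection, -reflection})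
    (fun γ hγ => if_neg hγ), Finset.sum_congr rfl (fun γ hγ => if_pos hγ), Finset.sum_const,
    card_fdo_stabilizers]
  simp

/-- Invariance of the measure transfers γ from S to 𝒟ᵒ; exchanging sum and integral then integrates
the constant count 4 over S. -/
theorem tsum_volume_fdo_inter {S : Set ℍ} (hS : MeasurableSet S) :
    ∑' γ : GL (Fin 2) ℤ, volume (𝒟ᵒ ∩ (fun τ => toGLReal γ • τ) ⁻¹' S) = 4 * volume S := by
  have hfdo : MeasurableSet 𝒟ᵒ := isOpen_fdo.measurableSet
  rw [← (Equiv.inv (GL (Fin 2) ℤ)).tsum_eq]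
  have h1 (γ : GL (Fin 2) ℤ) :
      volume (𝒟ᵒ ∩ (fun τ => toGLReal (Equiv.inv _ γ) • τ) ⁻¹' S)
        = ∫⁻ τ in S, 𝒟ᵒ.indicator (fun _ => (1 : ℝ≥0∞)) (toGLReal γ • τ) := by
    rw [← measure_preimage_smul volume (toGLReal γ), preimage_inter]
    have hm : MeasurableSet ((fun τ => toGLReal γ • τ) ⁻¹' 𝒟ᵒ) :=
      hfdo.preimage (measurable_const_smul _)
    change _ = ∫⁻ τ in S, ((fun τ => toGLReal γ • τ) ⁻¹' 𝒟ᵒ).indicator (fun _ => (1 : ℝ≥0∞)) τ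
    rw [lintegral_indicator_const hm, one_mul, Measure.restrict_apply hm]
    congr 2
    ext τ
    simp
  rw [tsum_congr h1, ← lintegral_tsum]
  · rw [setLIntegral_congr_fun_ae hS (g := fun _ => 4)]
    · simp
    · filter_upwards [tsum_indicator_fdo_smul] with τ hτ _ using hτ
  · intro γ
    exact ((measurable_const.indicator hfdo).comp (measurable_const_smul _)).aemeasurable

end ModularGroup

namespace BinaryCubicForm
open UpperHalfPlane Modular ModularGroup

theorem tsum_volume_fdo_inter_lowSet (R : ℝ) (f : BinaryCubicForm ℤ) :
    ∑' γ : GL (Fin 2) ℤ, volume (𝒟ᵒ ∩ lowSet R (γ • f).toReal)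
      = 4 * volume (lowSet R f.toReal) := by
  -- A point τ is low for γf iff (`twist γ`)⁻¹τ is low for f, hence the reindexing by γ ↦ `twist
  -- γ⁻¹`.
  rw [← tsum_volume_fdo_inter (isOpen_lowSet R f.toReal).measurableSet,
    ← ((Equiv.inv (GL (Fin 2) ℤ)).trans twist.toEquiv).tsum_eq fun γ => volume
      (𝒟ᵒ ∩ (fun τ => toGLReal γ • τ) ⁻¹' lowSet R f.toReal)]
  refine tsum_congr fun γ => congrArg _ ?_
  ext τ
  refine and_congr_right fun _ => Iff.trans ?_ (smul_mem_lowSet_iff R (toGLReal γ) f.toReal _)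
  have h1 : (γ • f).toReal = toGLReal γ • f.toReal := toReal_gl_smul γ f
  have h2 : twist (toGLReal γ) = toGLReal (twist γ) := (map_twist _ γ).symm
  rw [h1, h2, smul_smul, ← map_mul]
  simp

end BinaryCubicForm

/-- Choosing for each orbit point an element carrying x to it identifies G with orbit × stabilizer,
and the summand ignores the second factor. -/
theorem MulAction.card_stabilizer_mul_tsum_orbit {G X : Type*} [Group G] [MulAction G X] (x : X)
    [Finite (MulAction.stabilizer G x)] (φ : X → ℝ≥0∞) :
    Nat.card (MulAction.stabilizer G x) * ∑' y : MulAction.orbit G x, φ y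
      = ∑' g : G, φ (g • x) := by
  choose s hs using fun y : MulAction.orbit G x => y.2
  simp only at hs
  let e : MulAction.orbit G x × MulAction.stabilizer G x ≃ G :=
    { toFun := fun p => s p.1 * p.2
      invFun := fun g => (⟨g • x, g, rfl⟩, ⟨(s ⟨g • x, g, rfl⟩)⁻¹ * g, by
        rw [MulAction.mem_stabilizer_iff, mul_smul, inv_smul_eq_iff, hs]⟩)
      left_inv := by
        rintro ⟨y, h⟩
        have hy : (⟨(s y * h.1) • x, s y * h.1, rfl⟩ : MulAction.orbit G x) = y :=
          Subtype.ext (show (s y * h.1) • x = y by rw [mul_smul, h.2, hs])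
        ext1
        · exact hy
        · apply Subtype.ext
          simp only [hy, inv_mul_cancel_left]
      right_inv := fun g => by simp }
  rw [← e.tsum_eq, ENNReal.tsum_prod (f := fun y h => φ (e (y, h) • x)), ← ENNReal.tsum_mul_left]
  refine tsum_congr fun y => ?_
  have : ∀ h : MulAction.stabilizer G x, φ (e (y, h) • x) = φ y := fun h => by
    change φ ((s y * h.1) • x) = φ y
    rw [mul_smul, h.2, hs]
  rw [tsum_congr this, ENNReal.tsum_const, ENat.card_eq_coe_natCard]
  simp

namespace BinaryCubicForm
open UpperHalfPlane Modular ModularGroup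

theorem card_stabilizer_mul_tsum_orbit_volume (R : ℝ) (f : BinaryCubicForm ℤ)
    [Finite (MulAction.stabilizer (GL (Fin 2) ℤ) f)] :
    Nat.card (MulAction.stabilizer (GL (Fin 2) ℤ) f) *
      ∑' g : MulAction.orbit (GL (Fin 2) ℤ) f,
        volume (𝒟ᵒ ∩ lowSet R (g : BinaryCubicForm ℤ).toReal)
      = 4 * volume (lowSet R f.toReal) := by
  rw [← tsum_volume_fdo_inter_lowSet, MulAction.card_stabilizer_mul_tsum_orbit f
    fun g => volume (𝒟ᵒ ∩ lowSet R g.toReal)]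

end BinaryCubicForm

/-! ### The discrete steps of the algorithm -/

namespace CubicSampling

open BinaryCubicForm

theorem uniformBelow_apply {l k : ℕ} (hk : k < l) : uniformBelow l k = (l : ℝ≥0∞)⁻¹ := by
  have hl : l ≠ 0 := by omega
  rw [uniformBelow, dif_neg hl, PMF.uniformOfFinset_apply_of_mem _ (Finset.mem_range.2 hk),
    Finset.card_range]

/-- One step of `samplePoint`: the choice of the `i`-th coordinate. -/
noncomputable def sampleStep {n : ℕ} (x : Fin n → ℝ) (l : Fin n → ℕ)
    (M : Matrix (Fin n) (Fin n) ℝ) (v : Fin n → ℤ) (i : Fin n) : PMF (Fin n → ℤ) :=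
  (uniformBelow (l i)).bind fun δ =>
    PMF.pure (Function.update v i (⌈x i - ∑ j with j < i, M⁻¹ i j * v j⌉ + δ))

/-- Generalized over the list L of coordinates still to be drawn and the current state w, so that
induction applies. Since L is increasing, w already agrees with v below the next index; the ceilings
coincide and exactly one δ leads to v. -/
theorem foldlM_sampleStep_apply {n : ℕ} (x : Fin n → ℝ) (l : Fin n → ℕ)
    (M : Matrix (Fin n) (Fin n) ℝ) (v : Fin n → ℤ)
    (hv : ∀ i, ⌈x i - ∑ j with j < i, M⁻¹ i j * v j⌉ ≤ v i ∧
      v i < ⌈x i - ∑ j with j < i, M⁻¹ i j * v j⌉ + l i)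
    (L : List (Fin n)) (hL : L.Pairwise (· < ·))
    (w : Fin n → ℤ) :
    (L.foldlM (sampleStep x l M) w : PMF _) v
      = open Classical in if ∀ j, j ∉ L → w j = v j then (L.map fun i => (l i : ℝ≥0∞)⁻¹).prod
        else 0 := by
  classical
  induction L generalizing w with
  | nil =>
    simp only [List.foldlM_nil, List.map_nil, List.prod_nil, List.not_mem_nil, not_false_eq_true,
      forall_const]
    change PMF.pure w v = _
    rw [PMF.pure_apply]
    congr 1
    rw [eq_comm (a := v), funext_iff]
  | cons i L ih =>
    rw [List.pairwise_cons] at hL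
    have hiL : i ∉ L := fun h => lt_irrefl i (hL.1 i h)
    rw [List.foldlM_cons]
    change (PMF.bind (sampleStep x l M w i) fun w' => L.foldlM (sampleStep x l M) w') v = _
    rw [sampleStep, PMF.bind_bind]
    simp only [PMF.pure_bind]
    rw [PMF.bind_apply]
    simp only [ih hL.2]
    by_cases hw : ∀ j, j ∉ i :: L → w j = v j
    · rw [if_pos hw]
      have hsum : ∑ j with j < i, M⁻¹ i j * (w j : ℝ) = ∑ j with j < i, M⁻¹ i j * (v j : ℝ) := by
        refine Finset.sum_congr rfl fun j hj => ?_
        have hji : j < i := (Finset.mem_filter.1 hj).2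
        rw [hw j]
        rw [List.mem_cons, not_or]
        exact ⟨hji.ne, fun h => (hL.1 j h).not_gt hji⟩
      rw [hsum]
      obtain ⟨h1, h2⟩ := hv i
      set c := ⌈x i - ∑ j with j < i, M⁻¹ i j * (v j : ℝ)⌉
      obtain ⟨k, hk⟩ := Int.eq_ofNat_of_zero_le (sub_nonneg.2 h1)
      have hkl : k < l i := by omega
      rw [tsum_eq_single k]
      · rw [uniformBelow_apply hkl, if_pos, List.map_cons, List.prod_cons]
        intro j hj
        by_cases hji : j = i
        · subst hji
          rw [Function.update_self]
          omega
        · rw [Function.update_of_ne hji]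
          exact hw j (by simp [hji, hj])
      · intro δ hδ
        rw [if_neg, mul_zero]
        intro h
        have := h i hiL
        rw [Function.update_self] at this
        omega
    · rw [if_neg hw, ENNReal.tsum_eq_zero]
      intro δ
      rw [if_neg, mul_zero]
      intro h
      refine hw fun j hj => ?_
      rw [List.mem_cons, not_or] at hj
      rw [← h j hj.2, Function.update_of_ne hj.1]

theorem samplePoint_apply {n : ℕ} (x : Fin n → ℝ) (l : Fin n → ℕ)
    (M : Matrix (Fin n) (Fin n) ℝ) (v : Fin n → ℤ)
    (hv : ∀ i, ⌈x i - ∑ j with j < i, M⁻¹ i j * v j⌉ ≤ v i ∧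
      v i < ⌈x i - ∑ j with j < i, M⁻¹ i j * v j⌉ + l i) :
    samplePoint x l M v = ∏ i, (l i : ℝ≥0∞)⁻¹ := by
  have h : samplePoint x l M = ((List.finRange n).foldlM (sampleStep x l M) 0 : PMF _) := rfl
  rw [h, foldlM_sampleStep_apply x l M v hv _ (List.pairwise_lt_finRange n),
    if_pos (fun j hj => absurd (List.mem_finRange j) hj),
    ← List.ofFn_eq_map, List.prod_ofFn]

theorem coin_apply_true {p : ℝ≥0} (hp : p ≤ 1) : coin p true = p := by
  simp [coin, hp]

/-- The conditions under which the algorithm returns `f` in its final step. -/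
def IsAccepted (r : ℕ) (R T t s : ℝ) (f : BinaryCubicForm ℤ) : Prop :=
  f.toReal ∈ signatureSet r ∧ (0 < |f.toReal.disc| ∧ |f.toReal.disc| ≤ T) ∧
    f.IrreducibleOverRat ∧
    f.toReal ∈ (R * |f.toReal.disc| ^ (1 / 4 : ℝ)) • (nMat t * aMat s) • unitBall

open Classical in
theorem runAt_apply_some (r : ℕ) (R T t s : ℝ) (f : BinaryCubicForm ℤ) :
    runAt r R T t s (some f) =
      if ((1 - t ^ 2) ^ (1 / 4 : ℝ) < s ∧ s < sMax (R * T ^ (1 / 4 : ℝ)))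
          ∧ IsAccepted r R T t s f then
        coin (((∏ i, (intSide (R * T ^ (1 / 4 : ℝ)) s i : ℝ))
          / ∏ i, boundSide (R * T ^ (1 / 4 : ℝ)) i).toNNReal) true
        * samplePoint (fun i => -(1 / 2) * (intSide (R * T ^ (1 / 4 : ℝ)) s i : ℝ))
          (intSide (R * T ^ (1 / 4 : ℝ)) s) (nAct t) f.coeffs
      else 0 := by
  rw [runAt]
  set lam := R * T ^ (1 / 4 : ℝ) with hlam
  by_cases h1 : (1 - t ^ 2) ^ (1 / 4 : ℝ) < s ∧ s < sMax lam
  · simp only [h1, true_and]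
    change (PMF.bind _ _) (some f) = _
    rw [PMF.bind_apply, tsum_bool]
    have hnone : (PMF.pure none : PMF (Option (BinaryCubicForm ℤ))) (some f) = 0 := by simp
    have hfalse : (if false = true then
        (samplePoint (fun i => -(1 / 2) * (intSide lam s i : ℝ)) (intSide lam s) (nAct t)).bind
          fun v => if IsAccepted r R T t s (ofCoeffs v) then PMF.pure (some (ofCoeffs v))
            else PMF.pure none
        else PMF.pure none : PMF (Option (BinaryCubicForm ℤ))) (some f) = 0 := by simp
    refine (congrArg₂ (· + ·) (congrArg _ hfalse) (congrArg _ (PMF.bind_apply _ _ _))).trans ?_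
    rw [mul_zero, zero_add, tsum_eq_single f.coeffs]
    · have hf : ofCoeffs f.coeffs = f := rfl
      by_cases h2 : IsAccepted r R T t s f
      · rw [if_pos h2]
        refine congrArg _ ((congrArg _ ?_).trans (mul_one _))
        refine (congrFun (congrArg DFunLike.coe (if_pos h2)) _).trans ?_
        exact PMF.pure_apply_self _
      · rw [if_neg h2]
        refine (congrArg _ ((congrArg _ ?_).trans (mul_zero _))).trans (mul_zero _)
        refine (congrFun (congrArg DFunLike.coe (if_neg h2)) _).trans ?_
        exact hnone
    · intro v hv
      have hne : some f ≠ some (ofCoeffs v) := by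
        intro h
        apply hv
        rw [Option.some.inj h]
        ext i
        fin_cases i <;> rfl
      refine (congrArg _ ?_).trans (mul_zero _)
      by_cases h2 : IsAccepted r R T t s (ofCoeffs v)
      · refine (congrFun (congrArg DFunLike.coe (if_pos h2)) _).trans ?_
        exact PMF.pure_apply_of_ne _ _ hne
      · refine (congrFun (congrArg DFunLike.coe (if_neg h2)) _).trans ?_
        exact hnone
  · rw [if_neg h1, if_neg (fun h => h1 h.1)]
    change PMF.pure none (some f) = 0
    simp

end CubicSampling

/-! ### Probability of a given form once t and s are fixed -/

namespace CubicSampling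

open BinaryCubicForm UpperHalfPlane Modular ModularGroup

theorem nAct_mul_nAct_neg (t : ℝ) : nAct t * nAct (-t) = 1 := by
  ext i j
  fin_cases i <;> fin_cases j <;>
    simp [nAct, Matrix.mul_apply, Fin.sum_univ_four] <;> ring

theorem nAct_inv (t : ℝ) : (nAct t)⁻¹ = nAct (-t) :=
  Matrix.inv_eq_right_inv (nAct_mul_nAct_neg t)

theorem nAct_inv_mulVec (t : ℝ) (v : Fin 4 → ℝ) (i : Fin 4) :
    ((nAct t)⁻¹.mulVec v) i = ∑ j with j < i, (nAct t)⁻¹ i j * v j + v i := by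
  rw [nAct_inv]
  fin_cases i <;>
    simp [nAct, Matrix.mulVec, dotProduct, Fin.sum_univ_four, Finset.sum_filter]

theorem aMat_smul {s : ℝ} (hs : 0 < s) (g : BinaryCubicForm ℝ) :
    aMat s • g = ⟨(s ^ 3)⁻¹ * g.a, s⁻¹ * g.b, s * g.c, s ^ 3 * g.d⟩ := by
  apply gl_smul_eq_of_subst
  have h : (aMat s).val = !![s⁻¹, 0; 0, s] := by
    rw [aMat, dif_pos hs.ne']
    rfl
  rw [h, Matrix.det_fin_two]
  ext <;> simp [subst, BinaryCubicForm.smul_def] <;> field_simp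

/-- On q < λ² one has |a|, |d| < λ/2 from 5a² + 2ac + c² = 4a² + (a + c)², and |b|, |c| < √5λ/2 from
the same expression written as (5a + c)²/5 + 4c²/5. Then a(s) rescales the coordinates to the sides
lᵢ. -/
theorem abs_nAct_inv_mulVec_lt {f : BinaryCubicForm ℝ} {t s lam : ℝ} (hs : 0 < s) (hlam : 0 < lam)
    (h : f.height (point t s hs) < lam ^ 2) (i : Fin 4) :
    |((nAct t)⁻¹.mulVec f.coeffs) i| < side lam s i / 2 := by
  rw [height_point] at h
  obtain ⟨g, rfl⟩ : ∃ g, f = (nMat t * aMat s) • g := ⟨_, (smul_inv_smul _ f).symm⟩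
  rw [inv_smul_smul, q] at h
  rw [mul_smul, coeffs_nMat_smul, Matrix.mulVec_mulVec, Matrix.nonsing_inv_mul, Matrix.one_mulVec,
    aMat_smul hs]
  · have h5 : √5 ^ 2 = 5 := Real.sq_sqrt (by norm_num)
    have h5' : 0 < √5 := by positivity
    have ha : |g.a| < lam / 2 := abs_lt_of_sq_lt_sq
      (by nlinarith [sq_nonneg (g.a + g.c), sq_nonneg (g.b + g.d), sq_nonneg g.d]) (by positivity)
    have hd : |g.d| < lam / 2 := abs_lt_of_sq_lt_sq
      (by nlinarith [sq_nonneg (g.a + g.c), sq_nonneg (g.b + g.d), sq_nonneg g.a]) (by positivity)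
    have hb : |g.b| < √5 * lam / 2 := abs_lt_of_sq_lt_sq (by
      rw [div_pow, mul_pow, h5]
      nlinarith [sq_nonneg (g.a + g.c), sq_nonneg (5 * g.d + g.b), sq_nonneg g.a]) (by positivity)
    have hc : |g.c| < √5 * lam / 2 := abs_lt_of_sq_lt_sq (by
      rw [div_pow, mul_pow, h5]
      nlinarith [sq_nonneg (g.b + g.d), sq_nonneg (5 * g.a + g.c), sq_nonneg g.d]) (by positivity)
    have hmul {x y k : ℝ} (hk : 0 < k) (hxy : |x| < y / 2) : |k * x| < y * k / 2 := by
      rw [abs_mul, abs_of_pos hk]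
      nlinarith
    fin_cases i
    · exact hmul (by positivity) ha
    · exact hmul (by positivity) hb
    · exact hmul hs hc
    · exact hmul (by positivity) hd
  · exact Matrix.isUnit_det_of_right_inverse (nAct_mul_nAct_neg t)

theorem sMin_pos : 0 < sMin := by
  rw [sMin]
  positivity

theorem sMin_pow_four : sMin ^ 4 = 3 / 4 := by
  rw [sMin, show (4 : ℕ) = 2 * 2 from rfl, pow_mul, Real.sq_sqrt (by positivity), div_pow,
    Real.sq_sqrt (by norm_num)]
  norm_num

theorem sMax_pow_three {lam : ℝ} (hlam : 0 < lam) : sMax lam ^ 3 = lam / 2 := by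
  rw [sMax, ← Real.rpow_natCast, ← Real.rpow_mul (by positivity)]
  norm_num

theorem sMax_pos {lam : ℝ} (hlam : 0 < lam) : 0 < sMax lam := by
  rw [sMax]
  positivity

theorem boundSide_pos {lam : ℝ} (hlam : 0 < lam) (i : Fin 4) : 0 < boundSide lam i := by
  have := sMin_pos
  have := sMax_pos hlam
  fin_cases i <;> simp [boundSide] <;> positivity

theorem side_pos {lam s : ℝ} (hlam : 0 < lam) (hs : 0 < s) (i : Fin 4) : 0 < side lam s i := by
  fin_cases i <;> simp [side] <;> positivity

theorem side_le_intSide {lam s : ℝ} (i : Fin 4) : side lam s i ≤ intSide lam s i := by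
  have := Nat.lt_floor_add_one (1 + side lam s i)
  rw [intSide]
  linarith

theorem intSide_pos {lam s : ℝ} (hlam : 0 < lam) (hs : 0 < s) (i : Fin 4) :
    0 < intSide lam s i := by
  have := (side_pos hlam hs i).trans_le (side_le_intSide i)
  exact_mod_cast this

theorem prod_intSide_le {lam s : ℝ} (hlam : 0 < lam) (hs : sMin < s) (hs' : s < sMax lam) :
    ∏ i, (intSide lam s i : ℝ) ≤ ∏ i, boundSide lam i := by
  have hm := sMin_pos
  have hs0 : 0 < s := hm.trans hs
  have h1 (i : Fin 4) : (intSide lam s i : ℝ) ≤ 1 + side lam s i :=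
    Nat.floor_le (by have := side_pos hlam hs0 i; linarith)
  calc ∏ i, (intSide lam s i : ℝ) ≤ ∏ i, (1 + side lam s i) :=
        Finset.prod_le_prod (fun i _ => by positivity) fun i _ => h1 i
    -- The factors 1 + lᵢ are multiplied by s³, s, s⁻¹, s⁻³, whose product is 1. Only after this
    -- redistribution is each factor bounded by its Lᵢ'.
    _ = (s ^ 3 + lam) * (s + √5 * lam) * (s⁻¹ + √5 * lam) * ((s ^ 3)⁻¹ + lam) := by
        simp only [Fin.prod_univ_four, side]
        simp
        field_simp
    _ ≤ ∏ i, boundSide lam i := by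
        have := sMax_pos hlam
        simp only [Fin.prod_univ_four, boundSide]
        simp
        gcongr

theorem mem_fdo_iff {t s : ℝ} (hs : 0 < s) (ht : t ∈ Ioo (-1 / 2 : ℝ) (1 / 2)) :
    point t s hs ∈ 𝒟ᵒ ↔ (1 - t ^ 2) ^ (1 / 4 : ℝ) < s := by
  have h1 : |(point t s hs).re| < 1 / 2 := abs_lt.2 ⟨(neg_div 2 (1 : ℝ)).symm.trans_lt ht.1, ht.2⟩
  have h2 : Complex.normSq (point t s hs : ℂ) = t ^ 2 + s ^ 4 := by
    change Complex.normSq ⟨t, s ^ 2⟩ = _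
    rw [Complex.normSq_mk]
    ring
  have h3 : 0 ≤ 1 - t ^ 2 := by nlinarith [ht.1, ht.2]
  have h4 : (1 - t ^ 2) ^ (1 / 4 : ℝ) < s ↔ 1 - t ^ 2 < s ^ 4 := by
    rw [one_div, Real.rpow_inv_lt_iff_of_pos h3 hs.le (by norm_num)]
    norm_cast
  rw [h4, sub_lt_iff_lt_add', ← h2]
  exact ⟨fun h => h.1, fun h => ⟨h, h1⟩⟩

open Classical in
-- The coin has probability ∏ lᵢ'/∏ Lᵢ' and the point f has probability 1/∏ lᵢ', so the dependence
-- on t and s cancels.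
theorem runAt_apply_some_eq {r : ℕ} {R T t s : ℝ} (hR : 0 < R) (hT : 1 ≤ T)
    (ht : t ∈ Ioo (-1 / 2 : ℝ) (1 / 2)) (hs : sMin < s) (f : BinaryCubicForm ℤ) :
    runAt r R T t s (some f) = if IsTarget r T f ∧
        point t s (sMin_pos.trans hs) ∈ 𝒟ᵒ ∩ lowSet R f.toReal then
      (ENNReal.ofReal (∏ i, boundSide (R * T ^ (1 / 4 : ℝ)) i))⁻¹ else 0 := by
  have hs0 := sMin_pos.trans hs
  rw [runAt_apply_some]
  have hT0 : 0 < T := by linarith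
  have hlam : 0 < R * T ^ (1 / 4 : ℝ) := by positivity
  by_cases htar : IsTarget r T f
  swap
  · rw [if_neg (fun h => htar ⟨h.2.2.2.1, h.2.1, h.2.2.1⟩), if_neg (fun h => htar h.1)]
  have hdisc := htar.2.2.1
  have hρ : (R * |f.toReal.disc| ^ (1 / 4 : ℝ)) ^ 2 = R ^ 2 * √|f.toReal.disc| := by
    rw [mul_pow, ← Real.rpow_natCast (_ ^ _), ← Real.rpow_mul (abs_nonneg _), Real.sqrt_eq_rpow]
    norm_num
  have hlow : f.toReal ∈ (R * |f.toReal.disc| ^ (1 / 4 : ℝ)) • (nMat t * aMat s) • unitBall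
      ↔ point t s hs0 ∈ lowSet R f.toReal := by
    rw [mem_smul_unitBall_iff _ (by positivity) t hs0, hρ]
    rfl
  by_cases hp : (1 - t ^ 2) ^ (1 / 4 : ℝ) < s ∧ point t s hs0 ∈ lowSet R f.toReal
  swap
  · rw [if_neg (fun h => hp ⟨h.1.1, hlow.1 h.2.2.2.2⟩),
      if_neg (fun h => hp ⟨(mem_fdo_iff hs0 ht).1 h.2.1, h.2.2⟩)]
  have hheight : f.toReal.height (point t s hs0) < (R * T ^ (1 / 4 : ℝ)) ^ 2 := by
    refine (show _ < _ from hp.2).trans_le ?_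
    rw [← hρ]
    have := htar.2.2.2
    gcongr
  have hbox := abs_nAct_inv_mulVec_lt hs0 hlam hheight
  -- The unipotent n(t) fixes the coefficient a, a nonzero integer by irreducibility; so 1 ≤ |a| <
  -- λs⁻³/2, that is, s³ < λ/2.
  have hmax : s < sMax (R * T ^ (1 / 4 : ℝ)) := by
    apply lt_of_pow_lt_pow_left₀ 3 (sMax_pos hlam).le
    rw [sMax_pow_three hlam]
    have h0 := hbox 0
    have h1 : ((nAct t)⁻¹.mulVec f.toReal.coeffs) 0 = (f.a : ℝ) := by
      rw [nAct_inv_mulVec]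
      simp [coeffs, toReal, BinaryCubicForm.map]
    rw [h1] at h0
    have ha : (1 : ℝ) ≤ |(f.a : ℝ)| := by
      exact_mod_cast Int.one_le_abs htar.1.a_ne_zero
    simp only [side, Matrix.cons_val_zero] at h0
    have h2 := ha.trans_lt h0
    rw [lt_div_iff₀ two_pos, lt_mul_inv_iff₀ (by positivity)] at h2
    linarith
  rw [if_pos ⟨⟨hp.1, hmax⟩, htar.2.1, htar.2.2, htar.1, hlow.2 hp.2⟩,
    if_pos ⟨htar, (mem_fdo_iff hs0 ht).2 hp.1, hp.2⟩]
  have hprod := prod_intSide_le hlam hs hmax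
  have hB : 0 < ∏ i, boundSide (R * T ^ (1 / 4 : ℝ)) i :=
    Finset.prod_pos fun i _ => boundSide_pos hlam i
  have hI : 0 < ∏ i, (intSide (R * T ^ (1 / 4 : ℝ)) s i : ℝ) :=
    Finset.prod_pos fun i _ => by exact_mod_cast intSide_pos hlam hs0 i
  rw [coin_apply_true, samplePoint_apply]
  · have hinv : ∏ i, (intSide (R * T ^ (1 / 4 : ℝ)) s i : ℝ≥0∞)⁻¹
        = (ENNReal.ofReal (∏ i, (intSide (R * T ^ (1 / 4 : ℝ)) s i : ℝ)))⁻¹ := by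
      rw [ENNReal.ofReal_prod_of_nonneg fun i _ => by positivity,
        ENNReal.prod_inv_distrib (by simp [Set.Pairwise])]
      simp
    rw [← ENNReal.ofReal, hinv, ENNReal.ofReal_div_of_pos hB, div_eq_mul_inv, mul_right_comm,
      ENNReal.mul_inv_cancel (by simpa using hI) ENNReal.ofReal_ne_top, one_mul]
  · intro i
    have hb := abs_lt.1 (hbox i)
    have hle := side_le_intSide (lam := R * T ^ (1 / 4 : ℝ)) (s := s) i
    rw [nAct_inv_mulVec] at hb
    have hcast (j : Fin 4) : f.toReal.coeffs j = (f.coeffs j : ℝ) := by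
      fin_cases j <;> rfl
    simp only [hcast] at hb
    constructor
    · rw [Int.ceil_le]
      linarith
    · rw [← sub_lt_iff_lt_add, Int.lt_ceil]
      push_cast
      linarith
  · rw [Real.toNNReal_le_one]
    exact (div_le_one hB).2 hprod

end CubicSampling

/-! ### The law of (t, s) and hyperbolic measure -/

namespace CubicSampling

open BinaryCubicForm UpperHalfPlane Modular ModularGroup

theorem sMeasure_univ_ne_zero : sMeasure univ ≠ 0 := by
  rw [sMeasure, withDensity_apply _ MeasurableSet.univ, Measure.restrict_univ]
  have hm : Measurable fun s : ℝ => ENNReal.ofReal ((s ^ 3)⁻¹) := by fun_prop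
  rw [Ne, lintegral_eq_zero_iff hm, Filter.EventuallyEq, ae_restrict_iff' measurableSet_Ioi,
    ae_iff]
  intro h
  have hsub : Ioi sMin ⊆ {s | ¬(s ∈ Ioi sMin → ENNReal.ofReal ((s ^ 3)⁻¹) = (0 : ℝ → ℝ≥0∞) s)} := by
    intro s hs
    have hs0 : 0 < s := sMin_pos.trans hs
    rw [mem_ofPred_eq, Classical.not_imp]
    refine ⟨hs, ?_⟩
    simp only [Pi.zero_apply, ENNReal.ofReal_eq_zero, not_le]
    positivity
  have := measure_mono_null hsub h
  simp at this

theorem sMeasure_univ_ne_top : sMeasure univ ≠ ∞ := by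
  rw [sMeasure, withDensity_apply _ MeasurableSet.univ, Measure.restrict_univ]
  have h := integrableOn_Ioi_rpow_of_lt (a := -3) (by norm_num) sMin_pos
  refine ne_of_lt (lt_of_eq_of_lt ?_ h.lintegral_lt_top)
  refine setLIntegral_congr_fun measurableSet_Ioi fun s hs => ?_
  have hs0 : 0 < s := sMin_pos.trans hs
  rw [Real.rpow_neg hs0.le]
  norm_cast

instance : IsProbabilityMeasure sLaw :=
  ⟨by rw [sLaw, Measure.smul_apply, smul_eq_mul,
    ENNReal.inv_mul_cancel sMeasure_univ_ne_zero sMeasure_univ_ne_top]⟩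

theorem tLaw_eq : tLaw = volume.restrict (Ioo (-1 / 2) (1 / 2)) := by
  rw [tLaw, ProbabilityTheory.cond, Real.volume_Ioo]
  norm_num

instance : IsProbabilityMeasure tLaw := ⟨by rw [tLaw_eq]; norm_num⟩

/-- The pairs `(t, s)` with `s > 0` for which `t + i s²` lies in `A`. -/
def pairs (A : Set ℍ) : Set (ℝ × ℝ) := {p | ∃ hs : 0 < p.2, point p.1 p.2 hs ∈ A}

theorem measurableSet_pairs {A : Set ℍ} (hA : MeasurableSet A) : MeasurableSet (pairs A) := by
  have h : pairs A = {p : ℝ × ℝ | 0 < p.2} ∩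
      (fun p : ℝ × ℝ => ((p.1 : ℂ) + (p.2 : ℂ) ^ 2 * Complex.I)) ⁻¹' (UpperHalfPlane.coe '' A) := by
    ext p
    have hp (hs : 0 < p.2) : (p.1 : ℂ) + (p.2 : ℂ) ^ 2 * Complex.I = (point p.1 p.2 hs : ℂ) := by
      apply Complex.ext <;> simp [point, ← Complex.ofReal_pow]
    constructor
    · rintro ⟨hs, h⟩
      exact ⟨hs, _, h, (hp hs).symm⟩
    · rintro ⟨hs, τ, hτ, h⟩
      refine ⟨hs, ?_⟩
      have h := h.trans (hp hs)
      rwa [← UpperHalfPlane.ext h]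
  rw [h]
  refine (measurableSet_lt measurable_const measurable_snd).inter
    ((measurableEmbedding_coe.measurableSet_image.2 hA).preimage ?_)
  fun_prop

/-- The substitution y = s² turns dy/y² into 2s⁻³ ds. -/
theorem volume_eq_lintegral_pairs {A : Set ℍ} (hA : MeasurableSet A) :
    volume A = 2 * ∫⁻ t : ℝ, ∫⁻ s in Prod.mk t ⁻¹' pairs A, ENNReal.ofReal ((s ^ 3)⁻¹) := by
  have hB := measurableEmbedding_coe.measurableSet_image.2 hA
  have hpos (t : ℝ) : Prod.mk t ⁻¹' pairs A ⊆ Ioi 0 := fun s hs => hs.1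
  rw [volume_eq_lintegral, ← lintegral_indicator hB,
    ← Complex.volume_preserving_equiv_real_prod.symm.lintegral_comp_emb
      Complex.measurableEquivRealProd.symm.measurableEmbedding, Measure.volume_eq_prod,
    lintegral_prod, ← lintegral_const_mul' _ _ (by simp)]
  · refine lintegral_congr fun t => ?_
    have hfib : MeasurableSet (Prod.mk t ⁻¹' pairs A) :=
      (measurableSet_pairs hA).preimage measurable_prodMk_left
    have himg : (fun y : ℝ => Complex.measurableEquivRealProd.symm (t, y)) ⁻¹'
        (UpperHalfPlane.coe '' A) = (fun s : ℝ => s ^ 2) '' (Prod.mk t ⁻¹' pairs A) := by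
      ext y
      constructor
      · rintro ⟨τ, hτ, h⟩
        have hre : τ.re = t := congrArg Complex.re h
        have him : τ.im = y := congrArg Complex.im h
        have hy : 0 < y := him ▸ τ.im_pos
        have hsq : √y ^ 2 = y := Real.sq_sqrt hy.le
        refine ⟨√y, ⟨Real.sqrt_pos.2 hy, ?_⟩, hsq⟩
        convert! hτ
        apply UpperHalfPlane.ext
        apply Complex.ext
        · exact hre.symm
        · exact hsq.trans him.symm
      · rintro ⟨s, ⟨hs, h⟩, rfl⟩
        exact ⟨_, h, rfl⟩
    have hpre : MeasurableSet ((fun y : ℝ => Complex.measurableEquivRealProd.symm (t, y)) ⁻¹'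
        (UpperHalfPlane.coe '' A)) :=
      hB.preimage (Complex.measurableEquivRealProd.symm.measurable.comp measurable_prodMk_left)
    calc ∫⁻ y : ℝ, (UpperHalfPlane.coe '' A).indicator
          (fun z : ℂ => (((1 / ‖z.im‖₊) ^ 2 : ℝ≥0) : ℝ≥0∞))
          (Complex.measurableEquivRealProd.symm (t, y))
        = ∫⁻ y in (fun s : ℝ => s ^ 2) '' (Prod.mk t ⁻¹' pairs A),
            (((1 / ‖y‖₊) ^ 2 : ℝ≥0) : ℝ≥0∞) := by
          rw [← himg, ← lintegral_indicator hpre]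
          rfl
      _ = ∫⁻ s in Prod.mk t ⁻¹' pairs A, ENNReal.ofReal |2 * s|
            * (((1 / ‖s ^ 2‖₊) ^ 2 : ℝ≥0) : ℝ≥0∞) := by
          refine lintegral_image_eq_lintegral_abs_deriv_mul hfib (fun s _ => ?_) ?_ _
          · simpa using (hasDerivAt_pow 2 s).hasDerivWithinAt
          · intro s hs s' hs' h
            exact (pow_left_inj₀ (hpos t hs).le (hpos t hs').le two_ne_zero).1 h
      _ = ∫⁻ s in Prod.mk t ⁻¹' pairs A, 2 * ENNReal.ofReal ((s ^ 3)⁻¹) := by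
          refine setLIntegral_congr_fun hfib fun s hs => ?_
          have hs0 : 0 < s := hpos t hs
          have h2 : (2 : ℝ≥0∞) = ENNReal.ofReal 2 := by simp
          rw [← ENNReal.ofReal_coe_nnreal, ← ENNReal.ofReal_mul (abs_nonneg _), h2,
            ← ENNReal.ofReal_mul two_pos.le, abs_of_pos (by positivity)]
          congr 1
          push_cast
          rw [Real.norm_of_nonneg (by positivity)]
          field_simp
      _ = _ := lintegral_const_mul' _ _ (by simp)
  · refine Measurable.aemeasurable ?_
    have hm : Measurable ((UpperHalfPlane.coe '' A).indicator
        (fun z : ℂ => (((1 / ‖z.im‖₊) ^ 2 : ℝ≥0) : ℝ≥0∞))) := by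
      refine Measurable.indicator ?_ hB
      fun_prop
    exact hm.comp Complex.measurableEquivRealProd.symm.measurable

theorem prod_law_pairs {A : Set ℍ} (hA : MeasurableSet A) (hfdo : A ⊆ 𝒟ᵒ) :
    (tLaw.prod sLaw) (pairs A) = (2 * sMeasure univ)⁻¹ * volume A := by
  have hG := measurableSet_pairs hA
  -- In 𝒟ᵒ one has 4·im² > 3, so s⁴ > 3/4 = s_min⁴: the sampled strip covers the whole domain.
  have hmem {t s : ℝ} (h : (t, s) ∈ pairs A) : t ∈ Ioo (-1 / 2 : ℝ) (1 / 2) ∧ sMin < s := by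
    obtain ⟨hs, h⟩ := h
    have h1 : |t| < 1 / 2 := (hfdo h).2
    have h2 := three_lt_four_mul_im_sq_of_mem_fdo (hfdo h)
    have h3 : (point t s hs).im = s ^ 2 := rfl
    rw [abs_lt, ← neg_div] at h1
    refine ⟨h1, lt_of_pow_lt_pow_left₀ 4 (le_of_lt hs) ?_⟩
    rw [sMin_pow_four]
    rw [h3] at h2
    nlinarith
  have hs (t : ℝ) : sLaw (Prod.mk t ⁻¹' pairs A) = (sMeasure univ)⁻¹ *
      ∫⁻ s in Prod.mk t ⁻¹' pairs A, ENNReal.ofReal ((s ^ 3)⁻¹) := by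
    have hfib : MeasurableSet (Prod.mk t ⁻¹' pairs A) := hG.preimage measurable_prodMk_left
    have hsub : Prod.mk t ⁻¹' pairs A ⊆ Ioi sMin := fun s hs => (hmem hs).2
    rw [sLaw, Measure.smul_apply, smul_eq_mul, sMeasure, withDensity_apply _ hfib,
      Measure.restrict_restrict hfib, inter_eq_left.2 hsub]
  rw [Measure.prod_apply hG, tLaw_eq, setLIntegral_eq_of_support_subset]
  · simp only [hs]
    rw [lintegral_const_mul' _ _ (ENNReal.inv_ne_top.2 sMeasure_univ_ne_zero),
      volume_eq_lintegral_pairs hA, ENNReal.mul_inv (by simp) (by simp), mul_comm (2 : ℝ≥0∞)⁻¹,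
      mul_assoc, ← mul_assoc (2 : ℝ≥0∞)⁻¹, ENNReal.inv_mul_cancel (by simp) (by simp), one_mul]
  · intro t ht
    obtain ⟨s, hs⟩ := nonempty_of_measure_ne_zero ht
    exact (hmem hs).1

end CubicSampling

/-! ### The output law on forms and on orbits -/

namespace CubicSampling

open BinaryCubicForm UpperHalfPlane Modular ModularGroup

instance : Countable (BinaryCubicForm ℤ) := by
  refine Function.Injective.countable (f := BinaryCubicForm.coeffs) fun f g h => ?_
  exact BinaryCubicForm.ext (congrFun h 0) (congrFun h 1) (congrFun h 2) (congrFun h 3)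

instance : DiscreteMeasurableSpace (Option (BinaryCubicForm ℤ)) := ⟨fun _ => trivial⟩

/-- The probability with which each target form in range is returned. -/
noncomputable def weight (R T : ℝ) : ℝ≥0∞ :=
  (ENNReal.ofReal (∏ i, boundSide (R * T ^ (1 / 4 : ℝ)) i))⁻¹

theorem ae_mem_domain :
    ∀ᵐ p ∂(tLaw.prod sLaw), p ∈ Ioo (-1 / 2 : ℝ) (1 / 2) ×ˢ Ioi sMin := by
  have hs : sLaw (Ioi sMin) = 1 := by
    rw [← measure_univ (μ := sLaw), sLaw, Measure.smul_apply, Measure.smul_apply, sMeasure,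
      withDensity_apply _ measurableSet_Ioi, withDensity_apply _ MeasurableSet.univ,
      Measure.restrict_restrict measurableSet_Ioi, inter_self, Measure.restrict_univ]
  have ht : tLaw (Ioo (-1 / 2) (1 / 2)) = 1 := by
    rw [tLaw_eq]
    norm_num
  have hE : MeasurableSet (Ioo (-1 / 2 : ℝ) (1 / 2) ×ˢ Ioi sMin) :=
    measurableSet_Ioo.prod measurableSet_Ioi
  exact (mem_ae_iff_prob_eq_one hE).2 (by rw [Measure.prod_prod, hs, ht, one_mul])

theorem runAt_apply_some_eq_indicator {r : ℕ} {R T : ℝ} (hR : 0 < R) (hT : 1 ≤ T)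
    {p : ℝ × ℝ} (hp : p ∈ Ioo (-1 / 2 : ℝ) (1 / 2) ×ˢ Ioi sMin) {f : BinaryCubicForm ℤ}
    (hf : IsTarget r T f) :
    runAt r R T p.1 p.2 (some f)
      = (pairs (𝒟ᵒ ∩ lowSet R f.toReal)).indicator (fun _ => weight R T) p := by
  classical
  have hs := sMin_pos.trans hp.2
  rw [runAt_apply_some_eq hR hT hp.1 hp.2, indicator_apply]
  simp only [hf, true_and]
  refine if_congr ⟨fun h => ⟨hs, h⟩, fun h => h.2⟩ rfl rfl

theorem runAt_apply_some_eq_zero {r : ℕ} {R T : ℝ} (t s : ℝ) {f : BinaryCubicForm ℤ}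
    (hf : ¬IsTarget r T f) : runAt r R T t s (some f) = 0 := by
  classical
  rw [runAt_apply_some, if_neg fun h => hf ⟨h.2.2.2.1, h.2.1, h.2.2.1⟩]

theorem measurableSet_fdo_inter_lowSet (R : ℝ) (f : BinaryCubicForm ℝ) :
    MeasurableSet (𝒟ᵒ ∩ lowSet R f) :=
  (isOpen_fdo.inter (isOpen_lowSet R f)).measurableSet

/-- The mass of `none` is one minus the countable sum of the others, so measurability on `some`
suffices. -/
theorem measurable_toMeasure_of_option {α X : Type*} [MeasurableSpace X] [Countable α]
    [MeasurableSpace (Option α)] [DiscreteMeasurableSpace (Option α)] {P : X → PMF (Option α)}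
    (hP : ∀ a, Measurable fun x => P x (some a)) : Measurable fun x => (P x).toMeasure := by
  have hnone : Measurable fun x => P x none := by
    classical
    have : (fun x => P x none) = fun x => 1 - ∑' o, if o = none then 0 else P x o := by
      ext x
      have h := (P x).tsum_coe
      rw [ENNReal.tsum_eq_add_tsum_ite none] at h
      have h' : P x none + ∑' o, (if o = none then 0 else P x o) = 1 := by convert! h
      exact ENNReal.eq_sub_of_add_eq
        (ne_top_of_le_ne_top ENNReal.one_ne_top (h' ▸ le_add_self)) h'
    rw [this]
    refine measurable_const.sub (Measurable.tsum fun o => ?_)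
    cases o with
    | none => simp
    | some a => simpa using hP a
  refine Measure.measurable_of_measurable_coe _ fun A hA => ?_
  simp only [PMF.toMeasure_apply _ hA]
  refine Measurable.tsum fun o => ?_
  by_cases ho : o ∈ A
  · simp only [indicator_of_mem ho]
    cases o with
    | none => exact hnone
    | some a => exact hP a
  · simp only [indicator_of_notMem ho]
    exact measurable_const

theorem aemeasurable_runAt (r : ℕ) {R T : ℝ} (hR : 0 < R) (hT : 1 ≤ T) :
    AEMeasurable (fun p : ℝ × ℝ => (runAt r R T p.1 p.2).toMeasure) (tLaw.prod sLaw) := by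
  classical
  have hE : MeasurableSet (Ioo (-1 / 2 : ℝ) (1 / 2) ×ˢ Ioi sMin) :=
    measurableSet_Ioo.prod measurableSet_Ioi
  -- The formula for the probabilities is available only for (t, s) in the sampled strip; off this
  -- set of full measure the kernel is replaced by sure failure.
  let P : ℝ × ℝ → PMF (Option (BinaryCubicForm ℤ)) := fun p =>
    if p ∈ Ioo (-1 / 2 : ℝ) (1 / 2) ×ˢ Ioi sMin then runAt r R T p.1 p.2 else PMF.pure none
  refine ⟨fun p => (P p).toMeasure, measurable_toMeasure_of_option fun f => ?_, ?_⟩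
  · by_cases hf : IsTarget r T f
    · have : (fun p => P p (some f)) = (Ioo (-1 / 2 : ℝ) (1 / 2) ×ˢ Ioi sMin).indicator
          ((pairs (𝒟ᵒ ∩ lowSet R f.toReal)).indicator fun _ => weight R T) := by
        ext p
        by_cases hp : p ∈ Ioo (-1 / 2 : ℝ) (1 / 2) ×ˢ Ioi sMin
        · rw [indicator_of_mem hp, ← runAt_apply_some_eq_indicator hR hT hp hf]
          simp only [P, if_pos hp]
        · rw [indicator_of_notMem hp]
          simp only [P, if_neg hp]
          simp
      rw [this]
      exact (measurable_const.indicator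
        (measurableSet_pairs (measurableSet_fdo_inter_lowSet R _))).indicator hE
    · have : (fun p => P p (some f)) = fun _ => 0 := by
        ext p
        simp only [P]
        split_ifs
        · exact runAt_apply_some_eq_zero _ _ hf
        · simp
      rw [this]
      exact measurable_const
  · filter_upwards [ae_mem_domain] with p hp
    simp only [P, if_pos hp]

theorem outputLaw_apply (r : ℕ) {R T : ℝ} (hR : 0 < R) (hT : 1 ≤ T)
    (A : Set (Option (BinaryCubicForm ℤ))) :
    outputLaw r R T A = ∫⁻ p, (runAt r R T p.1 p.2).toMeasure A ∂(tLaw.prod sLaw) :=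
  Measure.bind_apply trivial (aemeasurable_runAt r hR hT)

theorem isProbabilityMeasure_outputLaw (r : ℕ) {R T : ℝ} (hR : 0 < R) (hT : 1 ≤ T) :
    IsProbabilityMeasure (outputLaw r R T) :=
  ⟨by rw [outputLaw_apply r hR hT]; simp⟩

theorem outputLaw_singleton {r : ℕ} {R T : ℝ} (hR : 0 < R) (hT : 1 ≤ T) {f : BinaryCubicForm ℤ}
    (hf : IsTarget r T f) :
    outputLaw r R T {some f}
      = weight R T * (2 * sMeasure univ)⁻¹ * volume (𝒟ᵒ ∩ lowSet R f.toReal) := by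
  rw [outputLaw_apply r hR hT]
  have hG := measurableSet_fdo_inter_lowSet R f.toReal
  calc ∫⁻ p, (runAt r R T p.1 p.2).toMeasure {some f} ∂(tLaw.prod sLaw)
      = ∫⁻ p, (pairs (𝒟ᵒ ∩ lowSet R f.toReal)).indicator (fun _ => weight R T) p
          ∂(tLaw.prod sLaw) := by
        refine lintegral_congr_ae ?_
        filter_upwards [ae_mem_domain] with p hp
        rw [PMF.toMeasure_apply_singleton _ _ (measurableSet_singleton _),
          runAt_apply_some_eq_indicator hR hT hp hf]
    _ = _ := by
        rw [lintegral_indicator_const (measurableSet_pairs hG),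
          prod_law_pairs hG inter_subset_left, mul_assoc]

theorem outputLaw_image_some {r : ℕ} {R T : ℝ} (hR : 0 < R) (hT : 1 ≤ T)
    {O : Set (BinaryCubicForm ℤ)} (hO : ∀ f ∈ O, IsTarget r T f) :
    outputLaw r R T (some '' O) = weight R T * (2 * sMeasure univ)⁻¹ *
      ∑' f : O, volume (𝒟ᵒ ∩ lowSet R (f : BinaryCubicForm ℤ).toReal) := by
  rw [← ENNReal.tsum_mul_left, ← biUnion_of_singleton (some '' O), biUnion_image,
    measure_biUnion (to_countable O)]
  · exact tsum_congr fun f => outputLaw_singleton hR hT (hO f f.2)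
  · intro f _ g _ hfg
    simpa using hfg
  · exact fun _ _ => measurableSet_singleton _

theorem outputLaw_orbit {r : ℕ} (hr : r = 1 ∨ r = 3) {R T : ℝ} (hR : 0 < R) (hT : 1 ≤ T)
    {f : BinaryCubicForm ℤ} (hf : IsTarget r T f) :
    outputLaw r R T (some '' MulAction.orbit (GL (Fin 2) ℤ) f)
      * Nat.card (MulAction.stabilizer (GL (Fin 2) ℤ) f)
      = weight R T * (2 * sMeasure univ)⁻¹ * (4 * volume (lowSet R f.toReal)) := by
  have := (finite_stabilizer_and_card_le (abs_pos.1 hf.2.2.1)).1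
  rw [outputLaw_image_some hR hT, ← card_stabilizer_mul_tsum_orbit_volume]
  · ring
  · rintro _ ⟨γ, rfl⟩
    exact (isTarget_gl_smul_iff hr T γ f).2 hf

end CubicSampling

/-! ### Many target forms sharing an open part of their low sets -/

namespace BinaryCubicForm

open UpperHalfPlane ComplexConjugate

theorem height_smul (x : ℝ) (f : BinaryCubicForm ℝ) (τ : ℍ) :
    (x • f).height τ = x ^ 2 * f.height τ := by
  have h (z w : ℂ) : (x • f).polar z w = x * f.polar z w := by
    simp only [polar, smul_def]
    push_cast
    ring
  simp only [height, h, map_mul, Complex.normSq_ofReal]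
  ring

theorem lowSet_smul (R : ℝ) {x : ℝ} (hx : 0 < x) (f : BinaryCubicForm ℝ) :
    lowSet R (x • f) = lowSet R f := by
  ext τ
  have h : √|x ^ 4 * f.disc| = x ^ 2 * √|f.disc| := by
    rw [abs_mul, Real.sqrt_mul (abs_nonneg _), abs_of_pos (by positivity),
      show x ^ 4 = (x ^ 2) ^ 2 by ring, Real.sqrt_sq (by positivity)]
  rw [lowSet, lowSet, mem_ofPred_eq, mem_ofPred_eq, height_smul, disc_smul, h, mul_left_comm]
  exact mul_lt_mul_iff_right₀ (by positivity)

theorem I_mem_lowSet {r : ℕ} {R : ℝ} (hR : 0 < R) {w : BinaryCubicForm ℝ}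
    (hw : w ∈ R • unitBall ∩ unitDiscSet r) : I ∈ lowSet R w := by
  obtain ⟨⟨b, hb, rfl⟩, hw⟩ := hw
  have hb' : q b < 1 := by
    rwa [unitBall, mem_ofPred_eq, Real.sqrt_lt' one_pos, one_pow] at hb
  have h1 : |(R • b).disc| = 1 := hw.2
  rw [lowSet, mem_ofPred_eq, height_I, h1, Real.sqrt_one, q_smul]
  nlinarith [pow_pos hR 2]

theorem volume_ne_zero_of_isOpen {U : Set ℍ} (hU : IsOpen U) (hne : U.Nonempty) :
    volume U ≠ 0 := by
  rw [volume_eq_lintegral]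
  refine (((setLIntegral_pos_iff (by fun_prop)).2 ?_)).ne'
  have hsub : UpperHalfPlane.coe '' U ⊆ (Function.support fun z : ℂ =>
      (((1 / ‖z.im‖₊) ^ 2 : ℝ≥0) : ℝ≥0∞)) ∩ UpperHalfPlane.coe '' U := by
    refine subset_inter ?_ subset_rfl
    rintro _ ⟨τ, -, rfl⟩
    simpa using τ.im_ne_zero
  exact ((isOpenEmbedding_coe.isOpenMap U hU).measure_pos volume (hne.image _)).trans_le
    (measure_mono hsub)

theorem disc_mul_disc_pos {r : ℕ} (hr : r = 1 ∨ r = 3) {f g : BinaryCubicForm ℝ}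
    (hf : f ∈ signatureSet r) (hg : g ∈ signatureSet r) (hf0 : f.disc ≠ 0) (hg0 : g.disc ≠ 0) :
    0 < f.disc * g.disc := by
  rw [mem_signatureSet_iff hr hf0] at hf
  rw [mem_signatureSet_iff hr hg0] at hg
  have h := mul_pos hf hg
  have h2 : discSign r ^ 2 = 1 := by
    rw [discSign]
    split_ifs <;> norm_num
  calc 0 < discSign r ^ 2 * (f.disc * g.disc) := by linarith
    _ = _ := by rw [h2, one_mul]

end BinaryCubicForm

namespace CubicSampling

open BinaryCubicForm UpperHalfPlane Modular ModularGroup ComplexConjugate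

/-- All the conditions are open jointly in the form and the point, so one good pair yields a product
neighbourhood. The pair comes from w₀, which is low at i, moved by g = a(2) so that i goes to 4i ∈
𝒟ᵒ. -/
theorem exists_box_subset_lowSet {r : ℕ} (hr : r = 1 ∨ r = 3) {R : ℝ} (hR : 0 < R)
    {w₀ : BinaryCubicForm ℝ} (hw₀ : w₀ ∈ R • unitBall ∩ unitDiscSet r) :
    ∃ (w : Fin 4 → ℝ) (ε : ℝ) (U : Set ℍ), 0 < ε ∧ IsOpen U ∧ U.Nonempty ∧ U ⊆ 𝒟ᵒ ∧
      ∀ v : Fin 4 → ℝ, (∀ i, |v i - w i| < ε) →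
        0 < discSign r * (ofCoeffs v).disc ∧ |(ofCoeffs v).disc| < 2 ∧
          U ⊆ lowSet R (ofCoeffs v) := by
  let g : GL (Fin 2) ℝ := nMat 0 * aMat 2
  have hdet : g.val.det = 1 := by
    rw [val_nMat_mul_aMat 0 two_pos, Matrix.det_fin_two]
    norm_num
  have hd0 : w₀.disc ≠ 0 := fun h => by
    have := hw₀.2.2
    rw [h] at this
    norm_num at this
  let O : Set ((Fin 4 → ℝ) × ℍ) := {p | (ofCoeffs p.1).height p.2 < R ^ 2 * √|(ofCoeffs p.1).disc|
    ∧ 0 < discSign r * (ofCoeffs p.1).disc ∧ |(ofCoeffs p.1).disc| < 2 ∧ p.2 ∈ 𝒟ᵒ}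
  have hdisc : Continuous fun p : (Fin 4 → ℝ) × ℍ => (ofCoeffs p.1).disc := by
    unfold disc ofCoeffs
    fun_prop
  have hheight : Continuous fun p : (Fin 4 → ℝ) × ℍ => (ofCoeffs p.1).height p.2 := by
    unfold height polar ofCoeffs
    refine Continuous.div (by fun_prop) (by fun_prop) fun p => ?_
    have := p.2.im_pos
    positivity
  have hO : IsOpen O := (isOpen_lt hheight (continuous_const.mul hdisc.abs.sqrt)).inter
    ((isOpen_lt continuous_const (continuous_const.mul hdisc)).inter
      ((isOpen_lt hdisc.abs continuous_const).inter (isOpen_fdo.preimage continuous_snd)))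
  have hmem : ((g • w₀).coeffs, point 0 2 two_pos) ∈ O := by
    have h1 : (g • w₀).disc = w₀.disc := by rw [disc_gl_smul, hdet, one_pow, one_mul]
    have h2 : ofCoeffs (g • w₀).coeffs = g • w₀ := rfl
    refine ⟨?_, ?_, ?_, ?_⟩
    · simp only [h2]
      rw [← twist_smul_I 0 two_pos]
      exact (smul_mem_lowSet_iff R g w₀ I).2 (I_mem_lowSet hR hw₀)
    · simp only [h2, h1]
      exact (mem_signatureSet_iff hr hd0).1 hw₀.2.1
    · simp only [h2, h1]
      rw [hw₀.2.2]
      norm_num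
    · rw [mem_fdo_iff two_pos (by norm_num)]
      norm_num
  obtain ⟨V, U, hV, hU, hwV, hτU, hVU⟩ := isOpen_prod_iff.1 hO _ _ hmem
  obtain ⟨ε, hε, hball⟩ := Metric.isOpen_iff.1 hV _ hwV
  refine ⟨(g • w₀).coeffs, ε, U, hε, hU, ⟨_, hτU⟩, fun τ hτ => (hVU (mk_mem_prod hwV hτ)).2.2.2,
    fun v hv => ?_⟩
  have hvV : v ∈ V := hball (by
    rw [Metric.mem_ball, dist_pi_lt_iff hε]
    exact hv)
  have h := fun τ (hτ : τ ∈ U) => hVU (mk_mem_prod hvV hτ)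
  exact ⟨(h _ hτU).2.1, (h _ hτU).2.2.1, fun τ hτ => (h τ hτ).1⟩

/-- The residue class modulo `2` of a form that is irreducible modulo `2`. -/
def oddClass : Fin 4 → ℤ := ![1, 0, 1, 1]

theorem exists_many_targets {r : ℕ} (hr : r = 1 ∨ r = 3) {R T : ℝ} (hT : 1 ≤ T)
    {w : Fin 4 → ℝ} {ε : ℝ} {U : Set ℍ} (hε : 0 < ε)
    (h : ∀ v : Fin 4 → ℝ, (∀ i, |v i - w i| < ε) →
        0 < discSign r * (ofCoeffs v).disc ∧ |(ofCoeffs v).disc| < 2 ∧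
          U ⊆ lowSet R (ofCoeffs v)) (hTε : 512 ≤ T * ε ^ 4) :
    ∃ F : Finset (BinaryCubicForm ℤ), T * ε ^ 4 / 512 ≤ F.card ∧
      ∀ f ∈ F, IsTarget r T f ∧ U ⊆ lowSet R f.toReal := by
  classical
  have hT0 : 0 < T := by linarith
  -- Dilating by κ multiplies discriminants by T/2, so |disc| < 2 in the box becomes |disc| < T. The
  -- bound 512 ≤ Tε⁴ is (κε)⁴ ≥ 4⁴.
  obtain ⟨κ, hκ, hκ4⟩ : ∃ κ : ℝ, 0 < κ ∧ κ ^ 4 = T / 2 :=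
    ⟨(T / 2) ^ (1 / 4 : ℝ), by positivity, by
      rw [← Real.rpow_natCast, ← Real.rpow_mul (by positivity)]; norm_num⟩
  have hκε : 4 ≤ κ * ε := by
    by_contra! hlt
    have : (κ * ε) ^ 4 < 4 ^ 4 := by gcongr
    rw [mul_pow, hκ4] at this
    linarith
  set m : ℕ := ⌊κ * ε / 2⌋₊ with hm
  have hm1 : (m : ℝ) ≤ κ * ε / 2 := Nat.floor_le (by positivity)
  have hm2 : κ * ε / 4 ≤ m := by
    have := Nat.lt_floor_add_one (κ * ε / 2)
    rw [← hm] at this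
    linarith
  -- Chosen so that the integers `oddClass i` + 2(⌊x i⌋ + 1 + k) with 0 ≤ k < m start just above
  -- κ(wᵢ − ε) and, as 2m ≤ κε, remain in the dilated box.
  let x : Fin 4 → ℝ := fun i => (κ * (w i - ε) - oddClass i) / 2
  let φ : (Fin 4 → Fin m) → BinaryCubicForm ℤ := fun k =>
    ofCoeffs fun i => oddClass i + 2 * (⌊x i⌋ + 1 + (k i : ℕ))
  have hφ : Function.Injective φ := by
    intro k k' hk
    have hc := congrArg BinaryCubicForm.coeffs hk
    have hi (i : Fin 4) : (oddClass i + 2 * (⌊x i⌋ + 1 + (k i : ℕ)) : ℤ)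
        = oddClass i + 2 * (⌊x i⌋ + 1 + (k' i : ℕ)) := by
      have := congrFun hc i
      fin_cases i <;> exact this
    ext i
    have := hi i
    omega
  refine ⟨Finset.univ.image φ, ?_, ?_⟩
  · rw [Finset.card_image_of_injective _ hφ]
    simp only [Finset.card_univ, Fintype.card_pi, Fintype.card_fin, Finset.prod_const]
    push_cast
    calc T * ε ^ 4 / 512 = (κ * ε / 4) ^ 4 := by rw [div_pow, mul_pow, hκ4]; ring
      _ ≤ (m : ℝ) ^ 4 := by gcongr
  · intro f hf
    obtain ⟨k, -, rfl⟩ := Finset.mem_image.1 hf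
    let u : Fin 4 → ℤ := fun i => oddClass i + 2 * (⌊x i⌋ + 1 + (k i : ℕ))
    let v : Fin 4 → ℝ := fun i => κ⁻¹ * u i
    have hv (i : Fin 4) : |v i - w i| < ε := by
      have h1 := Int.lt_floor_add_one (x i)
      have h2 := Int.floor_le (x i)
      have h3 : ((k i : ℕ) : ℝ) + 1 ≤ m := by exact_mod_cast (k i).2
      have h3' : (0 : ℝ) ≤ ((k i : ℕ) : ℝ) := by positivity
      have h4 : (u i : ℝ) = oddClass i + 2 * (⌊x i⌋ + 1 + (k i : ℕ)) := by
        simp only [u]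
        push_cast
        ring
      have h5 : 2 * x i = κ * (w i - ε) - oddClass i := by simp only [x]; ring
      have h6 : |κ * (v i - w i)| < κ * ε := by
        have : κ * (v i - w i) = u i - κ * w i := by simp only [v]; field_simp
        rw [this, abs_lt]
        constructor <;> nlinarith
      rw [abs_mul, abs_of_pos hκ] at h6
      exact lt_of_mul_lt_mul_left h6 hκ.le
    obtain ⟨hd1, hd2, hU⟩ := h v hv
    have hreal : (φ k).toReal = κ • ofCoeffs v := by
      have : ∀ i, (u i : ℝ) = κ * v i := fun i => by simp only [v]; field_simp
      ext
      · exact this 0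
      · exact this 1
      · exact this 2
      · exact this 3
    have hdisc : (φ k).toReal.disc = T / 2 * (ofCoeffs v).disc := by
      rw [hreal, disc_smul, hκ4]
    have hne : (ofCoeffs v).disc ≠ 0 := right_ne_zero_of_mul hd1.ne'
    have hne' : (φ k).toReal.disc ≠ 0 := by rw [hdisc]; positivity
    refine ⟨⟨irreducibleOverRat_of_odd ?_ ?_ ?_, ?_, abs_pos.2 hne', ?_⟩, ?_⟩
    · exact ⟨⌊x 0⌋ + 1 + (k 0 : ℕ), add_comm _ _⟩
    · exact ⟨⌊x 3⌋ + 1 + (k 3 : ℕ), add_comm _ _⟩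
    · refine ⟨⌊x 1⌋ + 1 + (k 1 : ℕ) + (⌊x 2⌋ + 1 + (k 2 : ℕ)), ?_⟩
      change (0 + 2 * (⌊x 1⌋ + 1 + (k 1 : ℕ))) + (1 + 2 * (⌊x 2⌋ + 1 + (k 2 : ℕ))) = _
      ring
    · rw [mem_signatureSet_iff hr hne', hdisc, mul_left_comm]
      positivity
    · rw [hdisc, abs_mul, abs_of_pos (by positivity)]
      nlinarith
    · rw [hreal, lowSet_smul R hκ]
      exact hU

theorem prod_boundSide_mono {lam lam' : ℝ} (hlam : 0 < lam) (h : lam ≤ lam') :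
    ∏ i, boundSide lam i ≤ ∏ i, boundSide lam' i := by
  refine Finset.prod_le_prod (fun i _ => (boundSide_pos hlam i).le) fun i _ => ?_
  have hs : sMax lam ≤ sMax lam' := by
    unfold sMax
    gcongr
  have := sMax_pos hlam
  fin_cases i <;> simp [boundSide] <;> gcongr

theorem prod_boundSide_le {lam : ℝ} (hlam : 1 ≤ lam) : ∏ i, boundSide lam i ≤ 360 * lam ^ 4 := by
  have h0 : 0 < lam := by linarith
  have hs := sMax_pos h0
  have hs' : sMax lam ≤ lam := by
    refine le_of_pow_le_pow_left₀ three_ne_zero h0.le ?_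
    rw [sMax_pow_three h0]
    nlinarith [one_le_pow₀ hlam (n := 2)]
  have hm : 1 / 2 ≤ sMin := by
    refine le_of_pow_le_pow_left₀ four_ne_zero sMin_pos.le ?_
    rw [sMin_pow_four]
    norm_num
  have hm1 : sMin⁻¹ ≤ 2 := by
    rw [inv_le_comm₀ sMin_pos two_pos]
    linarith
  have hm3 : (sMin ^ 3)⁻¹ ≤ 8 := by
    rw [← inv_pow]
    calc sMin⁻¹ ^ 3 ≤ 2 ^ 3 := pow_le_pow_left₀ (inv_nonneg.2 sMin_pos.le) hm1 3
      _ = 8 := by norm_num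
  have h5 : √5 ≤ 3 := Real.sqrt_le_iff.2 (by norm_num)
  have hmpos := sMin_pos
  have h5l : √5 * lam ≤ 3 * lam := by gcongr
  calc ∏ i, boundSide lam i
      = (sMax lam ^ 3 + lam) * (sMax lam + √5 * lam) * (sMin⁻¹ + √5 * lam)
        * ((sMin ^ 3)⁻¹ + lam) := by simp [Fin.prod_univ_four, boundSide]
    _ ≤ (2 * lam) * (4 * lam) * (5 * lam) * (9 * lam) := by
        rw [sMax_pow_three h0]
        gcongr <;> linarith
    _ = 360 * lam ^ 4 := by ring

end CubicSampling

/-! ### The success bound, the orbit constant and the theorem -/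

namespace CubicSampling

open BinaryCubicForm UpperHalfPlane Modular ModularGroup ComplexConjugate

theorem weight_ne_zero (R T : ℝ) : weight R T ≠ 0 :=
  ENNReal.inv_ne_zero.2 ENNReal.ofReal_ne_top

theorem density_ne_zero : (2 * sMeasure univ)⁻¹ ≠ 0 :=
  ENNReal.inv_ne_zero.2 (ENNReal.mul_ne_top (by simp) sMeasure_univ_ne_top)

theorem weight_antitone {R T T' : ℝ} (hR : 0 < R) (hT : 1 ≤ T) (h : T ≤ T') :
    weight R T' ≤ weight R T := by
  have : 0 < T := by linarith
  refine ENNReal.inv_le_inv.2 (ENNReal.ofReal_le_ofReal (prod_boundSide_mono (by positivity) ?_))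
  gcongr

theorem le_weight {R T : ℝ} (hT : 1 ≤ T) (h : 1 ≤ R * T ^ (1 / 4 : ℝ)) :
    (ENNReal.ofReal (360 * R ^ 4 * T))⁻¹ ≤ weight R T := by
  refine ENNReal.inv_le_inv.2 (ENNReal.ofReal_le_ofReal ((prod_boundSide_le h).trans_eq ?_))
  have hT4 : (T ^ (1 / 4 : ℝ)) ^ 4 = T := by
    rw [← Real.rpow_natCast, ← Real.rpow_mul (by linarith)]
    norm_num
  rw [mul_pow, hT4, mul_assoc]

theorem volume_lowSet_eq_of_isTarget {r : ℕ} (hr : r = 1 ∨ r = 3) {R T : ℝ}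
    {w₀ : BinaryCubicForm ℝ} (hw₀ : w₀ ∈ unitDiscSet r) {f : BinaryCubicForm ℤ}
    (hf : IsTarget r T f) : volume (lowSet R f.toReal) = volume (lowSet R w₀) := by
  refine volume_lowSet_eq R (disc_mul_disc_pos hr hf.2.1 hw₀.1 (abs_pos.1 hf.2.2.1) fun h => ?_)
  have := hw₀.2
  rw [h] at this
  norm_num at this

theorem outputLaw_ge_of_le {r : ℕ} (hr : r = 1 ∨ r = 3) {R T T₀ : ℝ} (hR : 0 < R) (hT : 1 ≤ T)
    (hTT₀ : T ≤ T₀) {w₀ : BinaryCubicForm ℝ} (hw₀ : w₀ ∈ unitDiscSet r) {f : BinaryCubicForm ℤ}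
    (hf : IsTarget r T f) :
    weight R T₀ * (2 * sMeasure univ)⁻¹ * (4 * volume (lowSet R w₀))
        / Nat.card (Fin 2 → Fin 2 → stabEntries) ≤ outputLaw r R T {o | o ≠ none} := by
  have hcard := (finite_stabilizer_and_card_le (abs_pos.1 hf.2.2.1)).2
  refine ENNReal.div_le_of_le_mul ?_
  calc weight R T₀ * (2 * sMeasure univ)⁻¹ * (4 * volume (lowSet R w₀))
      ≤ weight R T * (2 * sMeasure univ)⁻¹ * (4 * volume (lowSet R f.toReal)) := by
        rw [volume_lowSet_eq_of_isTarget hr hw₀ hf]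
        gcongr
        exact weight_antitone hR hT hTT₀
    _ = outputLaw r R T (some '' MulAction.orbit (GL (Fin 2) ℤ) f)
          * Nat.card (MulAction.stabilizer (GL (Fin 2) ℤ) f) := (outputLaw_orbit hr hR hT hf).symm
    _ ≤ _ := by
        gcongr
        rintro _ ⟨g, -, rfl⟩
        exact Option.some_ne_none g

theorem outputLaw_ge_of_large {r : ℕ} (hr : r = 1 ∨ r = 3) {R T : ℝ} (hR : 0 < R) (hT : 1 ≤ T)
    {w : Fin 4 → ℝ} {ε : ℝ} {U : Set ℍ} (hε : 0 < ε) (hU : U ⊆ 𝒟ᵒ)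
    (h : ∀ v : Fin 4 → ℝ, (∀ i, |v i - w i| < ε) →
        0 < discSign r * (ofCoeffs v).disc ∧ |(ofCoeffs v).disc| < 2 ∧
          U ⊆ lowSet R (ofCoeffs v))
    (hTε : 512 ≤ T * ε ^ 4) (hlam : 1 ≤ R * T ^ (1 / 4 : ℝ)) :
    ENNReal.ofReal (ε ^ 4 / (512 * (360 * R ^ 4))) * (2 * sMeasure univ)⁻¹ * volume U
      ≤ outputLaw r R T {o | o ≠ none} := by
  have hT0 : 0 < T := by linarith
  obtain ⟨F, hFcard, hF⟩ := exists_many_targets hr hT hε h hTε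
  have hsum : (F.card : ℝ≥0∞) * volume U
      ≤ ∑' f : (F : Set (BinaryCubicForm ℤ)),
        volume (𝒟ᵒ ∩ lowSet R (f : BinaryCubicForm ℤ).toReal) := by
    rw [F.tsum_subtype' fun f => volume (𝒟ᵒ ∩ lowSet R f.toReal), ← nsmul_eq_mul]
    exact Finset.card_nsmul_le_sum _ _ _ fun f hf =>
      measure_mono (subset_inter hU (hF f hf).2)
  have hconst : ENNReal.ofReal (ε ^ 4 / (512 * (360 * R ^ 4))) ≤ weight R T * F.card := by
    calc ENNReal.ofReal (ε ^ 4 / (512 * (360 * R ^ 4)))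
        = (ENNReal.ofReal (360 * R ^ 4 * T))⁻¹ * ENNReal.ofReal (T * ε ^ 4 / 512) := by
          rw [← ENNReal.ofReal_inv_of_pos (by positivity), ← ENNReal.ofReal_mul (by positivity)]
          congr 1
          field_simp
      _ ≤ weight R T * F.card := by
          gcongr
          · exact le_weight hT hlam
          · exact ENNReal.ofReal_le_of_le_toReal (by simpa using hFcard)
  calc ENNReal.ofReal (ε ^ 4 / (512 * (360 * R ^ 4))) * (2 * sMeasure univ)⁻¹ * volume U
      ≤ weight R T * F.card * (2 * sMeasure univ)⁻¹ * volume U := by gcongr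
    _ = weight R T * (2 * sMeasure univ)⁻¹ * (F.card * volume U) := by ring
    _ ≤ weight R T * (2 * sMeasure univ)⁻¹ * _ := by gcongr
    _ = outputLaw r R T (some '' (F : Set (BinaryCubicForm ℤ))) :=
        (outputLaw_image_some hR hT fun f hf => (hF f hf).1).symm
    _ ≤ _ := by
        refine measure_mono ?_
        rintro _ ⟨g, -, rfl⟩
        exact Option.some_ne_none g

theorem exists_success_bound {r : ℕ} (hr : r = 1 ∨ r = 3) {R : ℝ} (hR : 0 < R)
    (hU : (R • unitBall ∩ unitDiscSet r).Nonempty) :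
    ∃ p₀ : ℝ, 0 < p₀ ∧ ∀ T : ℝ, 1 ≤ T → (∃ f : BinaryCubicForm ℤ, IsTarget r T f) →
      p₀ < (outputLaw r R T).real {o | o ≠ none} := by
  obtain ⟨w₀, hw₀⟩ := hU
  obtain ⟨w, ε, U, hε, hUo, hUne, hUfdo, hbox⟩ := exists_box_subset_lowSet hr hR hw₀
  -- The first entry makes the dilated box large enough for the count; the second ensures λ ≥ 1,
  -- needed for ∏ Lᵢ' ≤ 360λ⁴.
  set T₀ : ℝ := max (512 / ε ^ 4) (1 / R ^ 4) with hT₀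
  set x₁ : ℝ≥0∞ := weight R T₀ * (2 * sMeasure univ)⁻¹ * (4 * volume (lowSet R w₀))
        / Nat.card (Fin 2 → Fin 2 → stabEntries)
  set x₂ : ℝ≥0∞ := ENNReal.ofReal (ε ^ 4 / (512 * (360 * R ^ 4))) * (2 * sMeasure univ)⁻¹ * volume U
  have hx₁ : x₁ ≠ 0 := by
    refine ENNReal.div_ne_zero.2 ⟨mul_ne_zero (mul_ne_zero (weight_ne_zero _ _) density_ne_zero)
      (mul_ne_zero (by simp) (volume_ne_zero_of_isOpen (isOpen_lowSet _ _)
        ⟨_, I_mem_lowSet hR hw₀⟩)), by simp⟩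
  have hx₂ : x₂ ≠ 0 := by
    refine mul_ne_zero (mul_ne_zero ?_ density_ne_zero) (volume_ne_zero_of_isOpen hUo hUne)
    rw [Ne, ENNReal.ofReal_eq_zero, not_le]
    positivity
  obtain ⟨p₀, hp₀, hlt⟩ := ENNReal.lt_iff_exists_nnreal_btwn.1
    (lt_min (pos_iff_ne_zero.2 hx₁) (pos_iff_ne_zero.2 hx₂))
  refine ⟨p₀, by exact_mod_cast hp₀, fun T hT ⟨f, hf⟩ => ?_⟩
  have := isProbabilityMeasure_outputLaw r hR hT
  have hT0 : 0 < T := by linarith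
  have hge : min x₁ x₂ ≤ outputLaw r R T {o | o ≠ none} := by
    rcases le_total T T₀ with h | h
    · exact (min_le_left _ _).trans (outputLaw_ge_of_le hr hR hT h hw₀.2 hf)
    · refine (min_le_right _ _).trans (outputLaw_ge_of_large hr hR hT hε hUfdo hbox ?_ ?_)
      · rw [← div_le_iff₀ (by positivity)]
        exact (le_max_left _ _).trans h
      · have h1 : 1 / R ^ 4 ≤ T := (le_max_right _ _).trans h
        have h4 : (R * T ^ (1 / 4 : ℝ)) ^ 4 = R ^ 4 * T := by
          rw [mul_pow, ← Real.rpow_natCast (T ^ _), ← Real.rpow_mul hT0.le]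
          norm_num
        rw [div_le_iff₀' (by positivity)] at h1
        refine le_of_pow_le_pow_left₀ four_ne_zero (by positivity) ?_
        rw [h4, one_pow]
        exact h1
  have := (ENNReal.toReal_lt_toReal ENNReal.coe_ne_top (measure_ne_top _ _)).2 (hlt.trans_le hge)
  exact this

theorem exists_orbit_constant {r : ℕ} (hr : r = 1 ∨ r = 3) {R T : ℝ} (hR : 0 < R) (hT : 1 ≤ T)
    (hU : (R • unitBall ∩ unitDiscSet r).Nonempty) :
    ∃ D : ℝ, 0 < D ∧ ∀ f : BinaryCubicForm ℤ, IsTarget r T f →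
      Finite (MulAction.stabilizer (GL (Fin 2) ℤ) f) ∧
      (outputLaw r R T).real (some '' MulAction.orbit (GL (Fin 2) ℤ) f)
        = D * (1 / (Nat.card (MulAction.stabilizer (GL (Fin 2) ℤ) f) : ℝ)) := by
  obtain ⟨w₀, hw₀⟩ := hU
  have := isProbabilityMeasure_outputLaw r hR hT
  by_cases hex : ∃ f : BinaryCubicForm ℤ, IsTarget r T f
  swap
  · exact ⟨1, one_pos, fun f hf => absurd ⟨f, hf⟩ hex⟩
  set x : ℝ≥0∞ := weight R T * (2 * sMeasure univ)⁻¹ * (4 * volume (lowSet R w₀)) with hx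
  have horb {f : BinaryCubicForm ℤ} (hf : IsTarget r T f) :
      outputLaw r R T (some '' MulAction.orbit (GL (Fin 2) ℤ) f)
        * Nat.card (MulAction.stabilizer (GL (Fin 2) ℤ) f) = x := by
    rw [outputLaw_orbit hr hR hT hf, volume_lowSet_eq_of_isTarget hr hw₀.2 hf]
  have hx0 : x ≠ 0 := mul_ne_zero (mul_ne_zero (weight_ne_zero _ _) density_ne_zero)
    (mul_ne_zero (by simp) (volume_ne_zero_of_isOpen (isOpen_lowSet _ _) ⟨_, I_mem_lowSet hR hw₀⟩))
  -- Finiteness is read off from an actual target: x is a probability times a finite cardinality, so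
  -- the low set's volume need not be estimated.
  have hxt : x ≠ ∞ := by
    obtain ⟨f, hf⟩ := hex
    rw [← horb hf]
    exact ENNReal.mul_ne_top (measure_ne_top _ _) (ENNReal.natCast_ne_top _)
  refine ⟨x.toReal, ENNReal.toReal_pos hx0 hxt, fun f hf => ?_⟩
  have hfin := (finite_stabilizer_and_card_le (abs_pos.1 hf.2.2.1)).1
  refine ⟨hfin, ?_⟩
  have hcard : (Nat.card (MulAction.stabilizer (GL (Fin 2) ℤ) f) : ℝ) ≠ 0 := by
    exact_mod_cast Nat.card_pos.ne'
  rw [← horb hf, ENNReal.toReal_mul, ENNReal.toReal_natCast, mul_one_div,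
    mul_div_cancel_right₀ _ hcard]
  rfl

theorem isTarget_of_mem_support {r : ℕ} {R T t s : ℝ} {f : BinaryCubicForm ℤ}
    (h : some f ∈ (runAt r R T t s).support) : IsTarget r T f := by
  by_contra hf
  exact h (runAt_apply_some_eq_zero t s hf)

end CubicSampling

theorem theorem3 (r : ℕ) (hr : r = 1 ∨ r = 3) (R : ℝ) (hR : 0 < R)
    (hU : (R • BinaryCubicForm.unitBall ∩ BinaryCubicForm.unitDiscSet r).Nonempty) :
    (∀ T : ℝ, 1 ≤ T →
      IsProbabilityMeasure (CubicSampling.outputLaw r R T) ∧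
      (∀ t ∈ Set.Ioo (-1 / 2 : ℝ) (1 / 2), ∀ s ∈ Set.Ioi CubicSampling.sMin,
        ∀ f : BinaryCubicForm ℤ, some f ∈ (CubicSampling.runAt r R T t s).support →
          BinaryCubicForm.IsTarget r T f) ∧
      (∃ D : ℝ, 0 < D ∧ ∀ f : BinaryCubicForm ℤ, BinaryCubicForm.IsTarget r T f →
        Finite (MulAction.stabilizer (Matrix.GeneralLinearGroup (Fin 2) ℤ) f) ∧
        (CubicSampling.outputLaw r R T).real
            (some '' MulAction.orbit (Matrix.GeneralLinearGroup (Fin 2) ℤ) f)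
          = D * (1 / (Nat.card (MulAction.stabilizer (Matrix.GeneralLinearGroup (Fin 2) ℤ) f) : ℝ))))
    ∧ ∃ p₀ : ℝ, 0 < p₀ ∧ ∀ T : ℝ, 1 ≤ T →
      (∃ f : BinaryCubicForm ℤ, BinaryCubicForm.IsTarget r T f) →
        p₀ < (CubicSampling.outputLaw r R T).real {o | o ≠ none} := by
  refine ⟨fun T hT => ⟨CubicSampling.isProbabilityMeasure_outputLaw r hR hT,
    fun t _ s _ f hf => CubicSampling.isTarget_of_mem_support hf,
    CubicSampling.exists_orbit_constant hr hR hT hU⟩,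
    CubicSampling.exists_success_bound hr hR hU⟩
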